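/- A Frölicher space is a set $X$ with a set of curves $\mathbb{R}\to X$ and a set of functions $X\to\mathbb{R}$ which determine each other: a map $c:\mathbb{R}\to X$ is a curve iff $\chi\circ c\in C^\infty(\mathbb{R},\mathbb{R})$ for all functions $\chi$, and a map $\chi:X\to\mathbb{R}$ is a function iff $\chi\circ c\in C^\infty(\mathbb{R},\mathbb{R})$ for all curves $c$. Smooth mappings are those that send curves to curves; they form the category $\mathbf{FS}$. For Frölicher spaces $X,Y$ let $X^Y$ be the set of smooth mappings $Y\to X$ with the Frölicher structure generated by the curves $c$ for which $\mathbb{R}\times Y\to X$, $(t,y)\mapsto c(t)(y)$, is smooth. A Weil algebra is a finite-dimensional local $\mathbb{R}$-algebra $W=C^\infty(\mathbb{R}^n)/I$, where the ideal $I$ consists of functions vanishing at $0$ (so that the residue field is $\mathbb{R}$, via evaluation at $0$). For $W_1=C^\infty(\mathbb{R}^n)/I$ and $W_2=C^\infty(\mathbb{R}^m)/J$ put $W_1\otimes_\infty W_2=C^\infty(\mathbb{R}^{n+m})/(I,J)$, where $(I,J)$ is the ideal generated by $I$ in the first $n$ variables and $J$ in the last $m$ variables. The Weil prolongation $X\otimes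 W$ is the quotient of $C^\infty(\mathbb{R}^n,X)$ by the relation $$f\equiv g \iff f(0)=g(0)\ \text{ and }\ \chi\circ f-\chi\circ g\in I\ \text{ for all functions }\chi\text{ on }X,$$ with the initial Frölicher structure for the maps $\chi\otimes W:X\otimes W\to\mathbb{R}\otimes W=W$, $[f]\mapsto[\chi\circ f]$, where $\chi$ ranges over the functions on $X$ and the finite-dimensional vector space $W$ has its usual smooth structure. A Frölicher space $X$ is called Weil-exponentiable if for every Frölicher space $Y$ and all Weil algebras $W_1,W_2$ as above one has canonically $$(X\otimes(W_1\otimes_\infty W_2))^Y\cong(X\otimes W_1)^Y\otimes W_2,$$ that is, there is an isomorphism in $\mathbf{FS}$ which, for each smooth $F:\mathbb{R}^n\times\mathbb{R}^m\to X^Y$, sends $y\mapsto[(u,z)\mapsto F(u,z)(y)]$ to the class of $z\mapsto\bigl(y\mapsto[u\mapsto F(u,z)(y)]\bigr)$. **Theorem.** The full subcategory $\mathbf{FS}_{\mathbf{WE}}$ of $\mathbf{FS}$ of all Weil-exponentiable Frölicher spaces is cartesian closed: it has finite products, and for each object $Y$ of $\mathbf{FS}_{\mathbf{WE}}$ the functor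 $Y\times(-)$ on $\mathbf{FS}_{\mathbf{WE}}$ has a right adjoint. -/

import Mathlib

open CategoryTheory
open scoped ContDiff

universe u

noncomputable section

/-! ### Smooth functions on `ℝⁿ` -/

/-- The `ℝ`-algebra `C^∞(ℝⁿ)` of smooth real functions on `ℝⁿ`, as a subalgebra of all functions. -/
def smoothSubalgebra (n : ℕ) : Subalgebra ℝ ((Fin n → ℝ) → ℝ) where
  carrier := {f | ContDiff ℝ ∞ f}
  mul_mem' := fun {f g} (hf : ContDiff ℝ ∞ f) (hg : ContDiff ℝ ∞ g) => hf.mul hg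
  add_mem' := fun {f g} (hf : ContDiff ℝ ∞ f) (hg : ContDiff ℝ ∞ g) => hf.add hg
  algebraMap_mem' r := (contDiff_const : ContDiff ℝ ∞ fun _ : Fin n → ℝ => r)

/-- `C^∞(ℝⁿ)`. -/
def SmoothFun (n : ℕ) : Type := smoothSubalgebra n

namespace SmoothFun

instance (n : ℕ) : CommRing (SmoothFun n) :=
  inferInstanceAs (CommRing (smoothSubalgebra n))

instance (n : ℕ) : Algebra ℝ (SmoothFun n) :=
  inferInstanceAs (Algebra ℝ (smoothSubalgebra n))

/-- A smooth function on `ℝⁿ` as an element of `C^∞(ℝⁿ)`. -/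
def mk {n : ℕ} (f : (Fin n → ℝ) → ℝ) (hf : ContDiff ℝ ∞ f) : SmoothFun n := ⟨f, hf⟩

/-- The function `ℝⁿ → ℝ` underlying an element of `C^∞(ℝⁿ)`. -/
def toFun {n : ℕ} (f : SmoothFun n) : (Fin n → ℝ) → ℝ := Subtype.val f

@[ext]
theorem ext {n : ℕ} {f g : SmoothFun n} (h : ∀ v, f.toFun v = g.toFun v) : f = g :=
  Subtype.ext (funext h)

theorem contDiff {n : ℕ} (f : SmoothFun n) : ContDiff ℝ ∞ f.toFun := Subtype.property f

/-- Evaluation at a point, as a homomorphism of `ℝ`-algebras. -/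
def eval {n : ℕ} (v : Fin n → ℝ) : SmoothFun n →ₐ[ℝ] ℝ where
  toFun f := f.toFun v
  map_one' := rfl
  map_mul' _ _ := rfl
  map_zero' := rfl
  map_add' _ _ := rfl
  commutes' _ := rfl

/-- The maximal ideal of the functions that vanish at the origin. -/
def maxIdeal (n : ℕ) : Ideal (SmoothFun n) := RingHom.ker (eval (0 : Fin n → ℝ))

/-- The `i`-th coordinate function. -/
def coord {n : ℕ} (i : Fin n) : SmoothFun n := mk (fun v => v i) (contDiff_apply ℝ ℝ i)

/-- Substitution `f ↦ f ∘ φ` along a smooth map `φ : ℝᵏ → ℝⁿ`. -/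
def subst {k n : ℕ} (φ : (Fin k → ℝ) → (Fin n → ℝ)) (hφ : ContDiff ℝ ∞ φ) :
    SmoothFun n →ₐ[ℝ] SmoothFun k where
  toFun f := mk (fun v => f.toFun (φ v)) (f.contDiff.comp hφ)
  map_one' := rfl
  map_mul' _ _ := rfl
  map_zero' := rfl
  map_add' _ _ := rfl
  commutes' _ := rfl

/-- `C^∞(ℝⁿ) → C^∞(ℝⁿ⁺ᵐ)`, `f ↦ ((x, y) ↦ f x)`. -/
def pullLeft (n m : ℕ) : SmoothFun n →ₐ[ℝ] SmoothFun (n + m) :=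
  subst (fun v i => v (Fin.castAdd m i)) (contDiff_pi.2 fun _ => contDiff_apply ℝ ℝ _)

/-- `C^∞(ℝᵐ) → C^∞(ℝⁿ⁺ᵐ)`, `f ↦ ((x, y) ↦ f y)`. -/
def pullRight (n m : ℕ) : SmoothFun m →ₐ[ℝ] SmoothFun (n + m) :=
  subst (fun v i => v (Fin.natAdd n i)) (contDiff_pi.2 fun _ => contDiff_apply ℝ ℝ _)

theorem mem_maxIdeal {n : ℕ} {f : SmoothFun n} : f ∈ maxIdeal n ↔ f.toFun 0 = 0 := Iff.rfl

/-- Differentiation under the integral sign. -/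
theorem contDiff_integral {E : Type} [NormedAddCommGroup E] [NormedSpace ℝ E]
    [FiniteDimensional ℝ E] (N : ℕ) :
    ∀ {F : Type} [NormedAddCommGroup F] [NormedSpace ℝ F] [FiniteDimensional ℝ F]
      (φ : E × ℝ → F), ContDiff ℝ ∞ φ → ContDiff ℝ N (fun x => ∫ t in (0 : ℝ)..1, φ (x, t)) := by
  induction N with
  | zero =>
    intro F _ _ _ φ hφ
    rw [Nat.cast_zero, contDiff_zero]
    exact intervalIntegral.continuous_parametric_intervalIntegral_of_continuous'
      (f := fun x t => φ (x, t)) hφ.continuous 0 1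
  | succ N ih =>
    intro F _ _ _ φ hφ
    have hD : ContDiff ℝ ∞ (fun p : E × ℝ =>
        (fderiv ℝ φ p).comp (ContinuousLinearMap.inl ℝ E ℝ)) :=
      (hφ.fderiv_right (by simp)).clm_comp contDiff_const
    have key : ∀ x, HasFDerivAt (fun x => ∫ t in (0 : ℝ)..1, φ (x, t))
        (∫ t in (0 : ℝ)..1, (fderiv ℝ φ (x, t)).comp (ContinuousLinearMap.inl ℝ E ℝ)) x := by
      intro x
      have hcpt : IsCompact (Metric.closedBall x 1 ×ˢ Set.Icc (0 : ℝ) 1) :=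
        (isCompact_closedBall x 1).prod isCompact_Icc
      obtain ⟨C, hC⟩ := hcpt.exists_bound_of_continuousOn hD.continuous.continuousOn
      refine intervalIntegral.hasFDerivAt_integral_of_dominated_of_fderiv_le
        (F := fun x t => φ (x, t)) (bound := fun _ => C)
        (F' := fun x t => (fderiv ℝ φ (x, t)).comp (ContinuousLinearMap.inl ℝ E ℝ))
        (Metric.closedBall_mem_nhds x one_pos) ?_ ?_ ?_ ?_ ?_ ?_
      · refine Filter.Eventually.of_forall fun y => ?_
        exact (hφ.continuous.comp (by fun_prop : Continuous fun t : ℝ => (y, t))).aestronglyMeasurable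
      · exact (hφ.continuous.comp
          (by fun_prop : Continuous fun t : ℝ => (x, t))).intervalIntegrable _ _
      · exact (hD.continuous.comp
          (by fun_prop : Continuous fun t : ℝ => (x, t))).aestronglyMeasurable
      · refine Filter.Eventually.of_forall fun t ht y hy => ?_
        rw [Set.uIoc_of_le zero_le_one] at ht
        exact hC (y, t) ⟨hy, ht.1.le, ht.2⟩
      · exact continuous_const.intervalIntegrable _ _
      · refine Filter.Eventually.of_forall fun t _ y _ => ?_
        have h1 : HasFDerivAt φ (fderiv ℝ φ (y, t)) (y, t) :=
          (hφ.differentiable (by simp)).differentiableAt.hasFDerivAt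
        exact h1.comp y (hasFDerivAt_prodMk_left y t)
    rw [Nat.cast_succ, contDiff_succ_iff_fderiv]
    refine ⟨fun x => (key x).differentiableAt, by simp, ?_⟩
    have : fderiv ℝ (fun x => ∫ t in (0 : ℝ)..1, φ (x, t)) = fun x =>
        ∫ t in (0 : ℝ)..1, (fderiv ℝ φ (x, t)).comp (ContinuousLinearMap.inl ℝ E ℝ) :=
      funext fun x => (key x).fderiv
    rw [this]
    exact ih _ hD

/-- Hadamard's lemma: the coordinate functions generate the maximal ideal at the origin. -/
theorem maxIdeal_le_span {n : ℕ} : maxIdeal n ≤ Ideal.span (Set.range (coord (n := n))) := by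
  intro f hf
  have hf0 : f.toFun 0 = 0 := hf
  have hfs : ContDiff ℝ ∞ f.toFun := f.contDiff
  have hg (i : Fin n) : ContDiff ℝ ∞
      (fun x : Fin n → ℝ => ∫ t in (0 : ℝ)..1, fderiv ℝ f.toFun (t • x) (Pi.single i 1)) := by
    refine contDiff_infty.2 fun N => contDiff_integral N
      (fun p : (Fin n → ℝ) × ℝ => fderiv ℝ f.toFun (p.2 • p.1) (Pi.single i 1)) ?_
    exact ((hfs.fderiv_right (m := ∞) (by simp)).comp (contDiff_snd.smul contDiff_fst)).clm_apply
      contDiff_const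
  have hsum : f = ∑ i, mk _ (hg i) * coord i := by
    ext x
    have hd : ∀ t : ℝ, HasDerivAt (fun t : ℝ => f.toFun (t • x)) (fderiv ℝ f.toFun (t • x) x) t := by
      intro t
      have h1 : HasFDerivAt f.toFun (fderiv ℝ f.toFun (t • x)) (t • x) :=
        (hfs.differentiable (by simp)).differentiableAt.hasFDerivAt
      have h2 : HasDerivAt (fun t : ℝ => t • x) x t := by
        simpa using (hasDerivAt_id t).smul_const x
      exact h1.comp_hasDerivAt t h2
    have hc (w : Fin n → ℝ) : Continuous (fun t : ℝ => fderiv ℝ f.toFun (t • x) w) :=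
      ((hfs.continuous_fderiv (by simp)).comp (by fun_prop)).clm_apply continuous_const
    have h3 := intervalIntegral.integral_eq_sub_of_hasDerivAt (a := (0 : ℝ)) (b := 1)
      (fun t _ => hd t) ((hc x).intervalIntegrable _ _)
    simp only [one_smul, zero_smul, hf0, sub_zero] at h3
    rw [← h3]
    have h4 : ∀ t : ℝ, fderiv ℝ f.toFun (t • x) x =
        ∑ i, fderiv ℝ f.toFun (t • x) (Pi.single i 1) * x i := by
      intro t
      have hx : x = ∑ i, x i • (Pi.single i (1 : ℝ) : Fin n → ℝ) := by
        ext j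
        simp [Pi.single_apply]
      have h5 (L : (Fin n → ℝ) →L[ℝ] ℝ) : L x = ∑ i, L (Pi.single i 1) * x i := by
        conv_lhs => rw [hx]
        rw [map_sum]
        exact Finset.sum_congr rfl fun i _ => by rw [map_smul, smul_eq_mul, mul_comm]
      exact h5 _
    have h6 : (∫ t in (0 : ℝ)..1, fderiv ℝ f.toFun (t • x) x) =
        ∑ i, (∫ t in (0 : ℝ)..1, fderiv ℝ f.toFun (t • x) (Pi.single i 1)) * x i := by
      simp_rw [h4]
      rw [intervalIntegral.integral_finsetSum (f := fun i t =>
          fderiv ℝ f.toFun (t • x) (Pi.single i 1) * x i)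
        fun i _ => ((hc _).mul continuous_const).intervalIntegrable _ _]
      simp only [intervalIntegral.integral_mul_const]
    exact h6.trans (map_sum (eval x) (fun i => mk _ (hg i) * coord i) Finset.univ).symm
  rw [hsum]
  exact Ideal.sum_mem _ fun i _ => Ideal.mul_mem_left _ _ (Ideal.subset_span ⟨i, rfl⟩)

/-- The algebra of `N`-jets at the origin is finite dimensional. -/
theorem finite_of_pow_le {n N : ℕ} {K : Ideal (SmoothFun n)} (h : maxIdeal n ^ N ≤ K) :
    Module.Finite ℝ (SmoothFun n ⧸ K) := by
  have main : ∀ N, ∃ V : Submodule ℝ (SmoothFun n), V.FG ∧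
      ∀ f : SmoothFun n, ∃ v ∈ V, f - v ∈ maxIdeal n ^ N := by
    intro N
    induction N with
    | zero => exact ⟨⊥, Submodule.fg_bot, fun f => ⟨0, Submodule.zero_mem _, by simp⟩⟩
    | succ N ih =>
      obtain ⟨V, hV, hVf⟩ := ih
      let T : Submodule ℝ (SmoothFun n) :=
        Submodule.span ℝ {1} ⊔ ⨆ i : Fin n, V.map (LinearMap.mulLeft ℝ (coord i))
      refine ⟨T, (Submodule.fg_span_singleton _).sup
        (Submodule.fg_iSup _ fun i => hV.map _), fun f => ?_⟩
      have hf : f - algebraMap ℝ _ (f.toFun 0) ∈ Ideal.span (Set.range (coord (n := n))) := by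
        apply maxIdeal_le_span
        change f.toFun 0 - f.toFun 0 = 0
        exact sub_self _
      obtain ⟨c, hc⟩ := (Ideal.mem_span_range_iff_exists_fun).1 hf
      choose v hv hvm using fun i => hVf (c i)
      refine ⟨algebraMap ℝ _ (f.toFun 0) + ∑ i, coord i * v i, ?_, ?_⟩
      · refine T.add_mem ?_ (T.sum_mem fun i _ => ?_)
        · rw [Algebra.algebraMap_eq_smul_one]
          exact Submodule.mem_sup_left (Submodule.smul_mem _ _ (Submodule.mem_span_singleton_self _))
        · exact Submodule.mem_sup_right (Submodule.mem_iSup_of_mem i ⟨v i, hv i, rfl⟩)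
      · have : f - (algebraMap ℝ _ (f.toFun 0) + ∑ i, coord i * v i) =
            ∑ i, (c i - v i) * coord i := by
          rw [← sub_sub, ← hc, ← Finset.sum_sub_distrib]
          exact Finset.sum_congr rfl fun i _ => by ring
        rw [this, pow_succ]
        exact Ideal.sum_mem _ fun i _ => Ideal.mul_mem_mul (hvm i) (mem_maxIdeal.2 rfl)
  obtain ⟨V, hV, hVf⟩ := main N
  rw [Module.finite_def]
  have : (⊤ : Submodule ℝ (SmoothFun n ⧸ K)) = V.map (Ideal.Quotient.mkₐ ℝ K).toLinearMap := by
    symm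
    rw [eq_top_iff]
    rintro x -
    obtain ⟨f, rfl⟩ := Ideal.Quotient.mk_surjective x
    obtain ⟨v, hv, hfv⟩ := hVf f
    exact ⟨v, hv, (Ideal.Quotient.eq.2 (h hfv)).symm⟩
  rw [this]
  exact hV.map _

theorem maxIdeal_isMaximal (n : ℕ) : (maxIdeal n).IsMaximal :=
  RingHom.ker_isMaximal_of_surjective _ fun r => ⟨algebraMap ℝ _ r, rfl⟩

/-- An ideal between a power of the maximal ideal and the maximal ideal has a local quotient. -/
theorem isLocal_of_pow_le {n N : ℕ} {K : Ideal (SmoothFun n)} (h : maxIdeal n ^ N ≤ K)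
    (hK : K ≤ maxIdeal n) : IsLocalRing (SmoothFun n ⧸ K) := by
  have hm := maxIdeal_isMaximal n
  have hmap : ((maxIdeal n).map (Ideal.Quotient.mk K)).IsMaximal :=
    Ideal.IsMaximal.map_of_surjective_of_ker_le Ideal.Quotient.mk_surjective (by simpa using hK)
  refine IsLocalRing.of_unique_max_ideal
    ⟨(maxIdeal n).map (Ideal.Quotient.mk K), hmap, fun M (hM : M.IsMaximal) => ?_⟩
  have h1 : maxIdeal n ≤ M.comap (Ideal.Quotient.mk K) := by
    have hp : (M.comap (Ideal.Quotient.mk K)).IsPrime := Ideal.comap_isPrime _ _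
    refine hp.le_of_pow_le (n := N) (h.trans ?_)
    intro x hx
    rw [Ideal.mem_comap, Ideal.Quotient.eq_zero_iff_mem.2 hx]
    exact M.zero_mem
  exact (hmap.eq_of_le hM.ne_top (Ideal.map_le_iff_le_comap.2 h1)).symm

end SmoothFun

/-! ### Weil algebras -/

/-- A Weil algebra `W = C^∞(ℝⁿ) / I`: a finite dimensional local `ℝ`-algebra, presented as a
quotient of `C^∞(ℝⁿ)` in such a way that its augmentation `W → ℝ` is evaluation at the origin. Since
`I` consists of functions vanishing at the origin, evaluation there is a surjection `W → ℝ`, whose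
kernel is the maximal ideal of `W`; so the residue field is `ℝ`. -/
structure WeilAlgebra where
  /-- the number `n` of generators -/
  dim : ℕ
  /-- the ideal `I` -/
  ideal : Ideal (SmoothFun dim)
  ideal_le : ideal ≤ SmoothFun.maxIdeal dim
  finite : Module.Finite ℝ (SmoothFun dim ⧸ ideal)
  isLocal : IsLocalRing (SmoothFun dim ⧸ ideal)

namespace WeilAlgebra

theorem isNilpotent_maximalIdeal (A : Type) [CommRing A] [Algebra ℝ A] [IsLocalRing A]
    (h : Module.Finite ℝ A) : ∃ k, IsLocalRing.maximalIdeal A ^ k = ⊥ := by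
  have : IsArtinianRing A := IsArtinianRing.of_finite ℝ A
  obtain ⟨k, hk⟩ := IsArtinianRing.isNilpotent_jacobson_bot (R := A)
  rw [IsLocalRing.jacobson_eq_maximalIdeal ⊥ bot_ne_top] at hk
  exact ⟨k, hk⟩

/-- The maximal ideal of a Weil algebra is nilpotent. -/
theorem exists_pow_le (W : WeilAlgebra) : ∃ k, SmoothFun.maxIdeal W.dim ^ k ≤ W.ideal := by
  have := W.isLocal
  obtain ⟨k, hk⟩ := isNilpotent_maximalIdeal (SmoothFun W.dim ⧸ W.ideal) W.finite
  refine ⟨k, ?_⟩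
  have hm := SmoothFun.maxIdeal_isMaximal W.dim
  have hmap : ((SmoothFun.maxIdeal W.dim).map (Ideal.Quotient.mk W.ideal)).IsMaximal :=
    Ideal.IsMaximal.map_of_surjective_of_ker_le Ideal.Quotient.mk_surjective
      (by simpa using W.ideal_le)
  rw [← IsLocalRing.eq_maximalIdeal hmap] at hk
  replace hk := (Ideal.map_pow (Ideal.Quotient.mk W.ideal) (SmoothFun.maxIdeal W.dim) k).trans hk
  intro x hx
  have h1 := Ideal.mem_map_of_mem (Ideal.Quotient.mk W.ideal) hx
  rw [hk] at h1
  exact Ideal.Quotient.eq_zero_iff_mem.1 h1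

/-- The ideal of `C^∞(ℝⁿ⁺ᵐ)` generated by `I` in the first `n` and `J` in the last `m` variables. -/
def tensorIdeal (W₁ W₂ : WeilAlgebra) : Ideal (SmoothFun (W₁.dim + W₂.dim)) :=
  W₁.ideal.map (SmoothFun.pullLeft W₁.dim W₂.dim) ⊔
    W₂.ideal.map (SmoothFun.pullRight W₁.dim W₂.dim)

theorem tensorIdeal_le (W₁ W₂ : WeilAlgebra) :
    tensorIdeal W₁ W₂ ≤ SmoothFun.maxIdeal (W₁.dim + W₂.dim) :=
  sup_le (Ideal.map_le_iff_le_comap.2 fun _ hf => W₁.ideal_le hf)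
    (Ideal.map_le_iff_le_comap.2 fun _ hf => W₂.ideal_le hf)

theorem exists_pow_le_tensorIdeal (W₁ W₂ : WeilAlgebra) :
    ∃ k, SmoothFun.maxIdeal (W₁.dim + W₂.dim) ^ k ≤ tensorIdeal W₁ W₂ := by
  obtain ⟨k, hk⟩ := W₁.exists_pow_le
  obtain ⟨l, hl⟩ := W₂.exists_pow_le
  refine ⟨k + l, ?_⟩
  have h1 : SmoothFun.maxIdeal (W₁.dim + W₂.dim) ≤
      (SmoothFun.maxIdeal W₁.dim).map (SmoothFun.pullLeft W₁.dim W₂.dim) ⊔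
        (SmoothFun.maxIdeal W₂.dim).map (SmoothFun.pullRight W₁.dim W₂.dim) := by
    refine SmoothFun.maxIdeal_le_span.trans (Ideal.span_le.2 ?_)
    rintro _ ⟨i, rfl⟩
    refine Fin.addCases (fun i => ?_) (fun i => ?_) i
    · exact Ideal.mem_sup_left (Ideal.mem_map_of_mem (SmoothFun.pullLeft W₁.dim W₂.dim)
        (x := SmoothFun.coord i) (SmoothFun.mem_maxIdeal.2 rfl))
    · exact Ideal.mem_sup_right (Ideal.mem_map_of_mem (SmoothFun.pullRight W₁.dim W₂.dim)
        (x := SmoothFun.coord i) (SmoothFun.mem_maxIdeal.2 rfl))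
  refine (Ideal.pow_right_mono h1 _).trans (Ideal.sup_pow_add_le_pow_sup_pow.trans ?_)
  rw [← Ideal.map_pow, ← Ideal.map_pow]
  exact sup_le_sup (Ideal.map_mono hk) (Ideal.map_mono hl)

/-- The tensor product (coproduct of `C^∞`-rings)
`C^∞(ℝⁿ)/I ⊗_∞ C^∞(ℝᵐ)/J = C^∞(ℝⁿ⁺ᵐ)/(I, J)`. -/
def tensor (W₁ W₂ : WeilAlgebra) : WeilAlgebra where
  dim := W₁.dim + W₂.dim
  ideal := tensorIdeal W₁ W₂
  ideal_le := tensorIdeal_le W₁ W₂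
  finite := (exists_pow_le_tensorIdeal W₁ W₂).elim fun _ h => SmoothFun.finite_of_pow_le h
  isLocal := (exists_pow_le_tensorIdeal W₁ W₂).elim fun _ h =>
    SmoothFun.isLocal_of_pow_le h (tensorIdeal_le W₁ W₂)

end WeilAlgebra

/-! ### Frölicher spaces -/

/-- A Frölicher space: a set with a class of curves `ℝ → X` and a class of functions `X → ℝ` that
determine each other through the condition that a function composed with a curve is smooth. -/
structure FrolicherSpace where
  /-- the underlying set -/
  carrier : Type u
  /-- the curves -/
  curves : Set (ℝ → carrier)
  /-- the functions -/
  functions : Set (carrier → ℝ)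
  mem_curves_iff : ∀ c, c ∈ curves ↔ ∀ f ∈ functions, ContDiff ℝ ∞ (fun t => f (c t))
  mem_functions_iff : ∀ f, f ∈ functions ↔ ∀ c ∈ curves, ContDiff ℝ ∞ (fun t => f (c t))

namespace FrolicherSpace

instance : CoeSort FrolicherSpace.{u} (Type u) := ⟨carrier⟩

/-- The Frölicher space generated by a set of functions: its curves are those that become smooth
under all the given functions. -/
def ofFunctions (α : Type u) (G : Set (α → ℝ)) : FrolicherSpace.{u} where
  carrier := α
  curves := {c | ∀ f ∈ G, ContDiff ℝ ∞ (fun t => f (c t))}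
  functions := {f | ∀ c : ℝ → α, (∀ g ∈ G, ContDiff ℝ ∞ (fun t => g (c t))) →
    ContDiff ℝ ∞ (fun t => f (c t))}
  mem_curves_iff c := ⟨fun hc _ hf => hf c hc, fun hc g hg => hc g fun _ hd => hd g hg⟩
  mem_functions_iff _ := Iff.rfl

/-- The Frölicher space generated by a set of curves: its functions are those that are smooth along
all the given curves. -/
def ofCurves (α : Type u) (C : Set (ℝ → α)) : FrolicherSpace.{u} where
  carrier := α
  curves := {c | ∀ f : α → ℝ, (∀ d ∈ C, ContDiff ℝ ∞ (fun t => f (d t))) →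
    ContDiff ℝ ∞ (fun t => f (c t))}
  functions := {f | ∀ c ∈ C, ContDiff ℝ ∞ (fun t => f (c t))}
  mem_curves_iff _ := Iff.rfl
  mem_functions_iff f := ⟨fun hf _ hc => hc f hf, fun hf c hc => hf c fun _ hg => hg c hc⟩

/-- The smooth mappings between Frölicher spaces: those that send curves to curves. -/
@[ext]
structure Hom (X Y : FrolicherSpace.{u}) where
  /-- the underlying map -/
  toFun : X → Y
  smooth : ∀ c ∈ X.curves, (fun t => toFun (c t)) ∈ Y.curves

/-- The category `FS` of Frölicher spaces and smooth mappings. -/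
instance : Category.{u} FrolicherSpace.{u} where
  Hom := Hom
  id X := ⟨fun x => x, fun _ hc => hc⟩
  comp f g := ⟨fun x => g.toFun (f.toFun x), fun c hc => g.smooth _ (f.smooth c hc)⟩

/-- The exponential `X^Y`: the set of smooth mappings `Y → X` with the structure generated by the
curves `c` for which `ℝ × Y → X`, `(t, y) ↦ c t y` is smooth; here a curve of `ℝ × Y` is a pair of a
smooth function `a : ℝ → ℝ` and a curve of `Y`. -/
def exponential (X Y : FrolicherSpace.{u}) : FrolicherSpace.{u} :=
  ofCurves (Hom Y X) {c | ∀ a : ℝ → ℝ, ContDiff ℝ ∞ a → ∀ y ∈ Y.curves,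
    (fun t => (c (a t)).toFun (y t)) ∈ X.curves}

/-- The set `C^∞(ℝⁿ, X)` of smooth mappings from `ℝⁿ` to a Frölicher space. As the functions of the
Frölicher space `ℝⁿ` are the usual smooth ones, and smooth mappings are those that pull functions
back to functions, this is the set of all `f` with `χ ∘ f ∈ C^∞(ℝⁿ)` for each function `χ` on `X`. -/
@[ext]
structure SmoothFrom (n : ℕ) (X : FrolicherSpace.{u}) where
  /-- the underlying map -/
  toFun : (Fin n → ℝ) → X
  smooth : ∀ χ ∈ X.functions, ContDiff ℝ ∞ (fun v => χ (toFun v))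

namespace SmoothFrom

variable {n m : ℕ} {X Y : FrolicherSpace.{u}}

/-- The composite `χ ∘ f ∈ C^∞(ℝⁿ)` of `f ∈ C^∞(ℝⁿ, X)` with a function `χ` on `X`. -/
def pull (χ : X.functions) (f : SmoothFrom n X) : SmoothFun n :=
  SmoothFun.mk (fun v => χ.1 (f.toFun v)) (f.smooth χ.1 χ.2)

/-- For `f ∈ C^∞(ℝⁿ⁺ᵐ, X)` and `z ∈ ℝᵐ`, the mapping `u ↦ f (u, z)` in `C^∞(ℝⁿ, X)`. -/
def slice (f : SmoothFrom (n + m) X) (z : Fin m → ℝ) : SmoothFrom n X where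
  toFun v := f.toFun (Fin.append v z)
  smooth χ hχ := by
    refine (f.smooth χ hχ).comp (contDiff_pi.2 fun i => ?_)
    refine Fin.addCases (fun i => ?_) (fun i => ?_) i
    · simpa using contDiff_apply ℝ ℝ i
    · simpa using contDiff_const

/-- For `F ∈ C^∞(ℝⁿ, X^Y)` and `y ∈ Y`, the mapping `v ↦ F v y` in `C^∞(ℝⁿ, X)`. -/
def evalAt (F : SmoothFrom n (X.exponential Y)) (y : Y) : SmoothFrom n X where
  toFun v := Hom.toFun (F.toFun v) y
  smooth χ hχ := by
    refine F.smooth (fun g : Hom Y X => χ (g.toFun y)) ?_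
    intro c hc
    exact (X.mem_functions_iff χ).1 hχ _ (hc (fun t => t) contDiff_id (fun _ => y)
      ((Y.mem_curves_iff _).2 fun _ _ => contDiff_const))

end SmoothFrom

/-! ### Weil prolongation -/

/-- The relation `f ≡ g mod I` on `C^∞(ℝⁿ, X)`. -/
def weilSetoid (X : FrolicherSpace.{u}) (W : WeilAlgebra) : Setoid (SmoothFrom W.dim X) where
  r f g := f.toFun 0 = g.toFun 0 ∧ ∀ χ : X.functions, f.pull χ - g.pull χ ∈ W.ideal
  iseqv :=
    { refl := fun f => ⟨rfl, fun χ => by rw [sub_self]; exact W.ideal.zero_mem⟩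
      symm := fun h => ⟨h.1.symm, fun χ => by
        rw [← neg_sub]; exact W.ideal.neg_mem (h.2 χ)⟩
      trans := fun h k => ⟨h.1.trans k.1, fun χ => by
        rw [← sub_add_sub_cancel]; exact W.ideal.add_mem (h.2 χ) (k.2 χ)⟩ }

/-- The mapping `χ ⊗ W : X ⊗ W → ℝ ⊗ W = C^∞(ℝⁿ) / I` induced by a function `χ` on `X`. -/
def prolongFunction (X : FrolicherSpace.{u}) (W : WeilAlgebra) (χ : X.functions) :
    Quotient (weilSetoid X W) → SmoothFun W.dim ⧸ W.ideal :=
  Quotient.lift (fun f => Ideal.Quotient.mk W.ideal (f.pull χ))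
    fun _ _ h => Ideal.Quotient.eq.2 (h.2 χ)

/-- The Weil prolongation `X ⊗ W`: the quotient of `C^∞(ℝⁿ, X)` by `≡ mod I`, with the initial smooth
structure for the mappings `χ ⊗ W` into `ℝ ⊗ W`. The latter is a finite dimensional vector space, so
that its smooth structure is generated by its linear functionals `ℓ`. -/
def prolong (X : FrolicherSpace.{u}) (W : WeilAlgebra) : FrolicherSpace.{u} :=
  ofFunctions (Quotient (weilSetoid X W))
    {θ | ∃ (χ : X.functions) (l : (SmoothFun W.dim ⧸ W.ideal) →ₗ[ℝ] ℝ),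
      θ = fun x => l (X.prolongFunction W χ x)}

/-- The class in `X ⊗ W` of a mapping `f ∈ C^∞(ℝⁿ, X)`. -/
def SmoothFrom.toProlong {X : FrolicherSpace.{u}} (W : WeilAlgebra) (f : SmoothFrom W.dim X) :
    X.prolong W :=
  Quotient.mk (weilSetoid X W) f

/-! ### Weil exponentiability -/

/-- `X` is Weil-exponentiable if `(X ⊗ (W₁ ⊗_∞ W₂))^Y = (X ⊗ W₁)^Y ⊗ W₂` canonically for any
Frölicher space `Y` and any Weil algebras `W₁ = C^∞(ℝⁿ)/I` and `W₂ = C^∞(ℝᵐ)/J`. That is, there is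
an isomorphism of Frölicher spaces between the two sides under which, for each smooth
`F : ℝⁿ × ℝᵐ → X^Y`, the element `k = (y ↦ [(u, z) ↦ F (u, z) y])` of the left hand side corresponds
to the class on the right hand side of `h = (z ↦ (y ↦ [u ↦ F (u, z) y]))`. -/
def IsWeilExponentiable : ObjectProperty FrolicherSpace.{u} := fun X =>
  ∀ (Y : FrolicherSpace.{u}) (W₁ W₂ : WeilAlgebra),
    ∃ Φ : (X.prolong (W₁.tensor W₂)).exponential Y ≅ ((X.prolong W₁).exponential Y).prolong W₂,
      ∀ (F : SmoothFrom (W₁.dim + W₂.dim) (X.exponential Y))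
        (k : (X.prolong (W₁.tensor W₂)).exponential Y)
        (h : SmoothFrom W₂.dim ((X.prolong W₁).exponential Y)),
        (∀ y : Y, Hom.toFun k y = SmoothFrom.toProlong (W₁.tensor W₂) (F.evalAt y)) →
        (∀ (z : Fin W₂.dim → ℝ) (y : Y),
          Hom.toFun (h.toFun z) y = SmoothFrom.toProlong W₁ ((F.evalAt y).slice z)) →
        Hom.toFun Φ.hom k = SmoothFrom.toProlong W₂ h

end FrolicherSpace

/-- The full subcategory `FS_WE` of `FS` of all Weil-exponentiable Frölicher spaces. -/
abbrev WeilExponentiableFrolicherSpace : Type (u + 1) :=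
  FrolicherSpace.IsWeilExponentiable.{u}.FullSubcategory

end

/-! The category of all Frölicher spaces is cartesian closed, and Weil-exponentiability is inherited
by the point, by binary products and by `X^Z` for arbitrary `Z`. As the subcategory is full, the
projections, evaluation and currying restrict to it.

Inheritance is formal once two facts are known: the exponential law `(X^Z)^Y ≅ X^(Z × Y)` in the
category of Frölicher spaces, and `(X × Y) ⊗ W ≅ (X ⊗ W) × (Y ⊗ W)`. Products are then handled
componentwise. For exponentials, `W₁ = ℝ` in the hypothesis on `X` gives `X^Z ⊗ W ≅ (X ⊗ W)^Z`,
whence `(X^Z ⊗ (W₁ ⊗_∞ W₂))^Y ≅ (X ⊗ (W₁ ⊗_∞ W₂))^(Z × Y) ≅ (X ⊗ W₁)^(Z × Y) ⊗ W₂ ≅ (X^Z ⊗ W₁)^Y ⊗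
W₂`.

Both facts rest on analysis. The structure of `X^Y` is only generated by the curves with smooth
adjunct, and the exponential law needs that there are no others (`mem_curves_exponential`). Given a
curve `c` of `X^Y`, a curve `y` of `Y` and a function `χ` on `X`, put `h t u = χ (c t (y u))`. The
functionals `g ↦ ∑ wᵤ (χ ∘ g ∘ y)⁽ᵖ⁾(u)`, for absolutely summable weights `w` on `[-R, R]`, are
functions on `X^Y`; so `h` depends weakly smoothly on `t`, as a mapping into the dual of an `ℓ¹`
space. Uniform boundedness makes all pure derivatives of `h` in `t` and in `u` locally bounded
(`contDiff_uncurry_of_weightedSum`). A function with such bounds along a basis is smooth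
(`contDiff_of_tameAlong_basis`), by interpolation between the size of a function and that of its
high derivatives. The same criterion yields Boman's theorem, used throughout to test smoothness in
several variables along curves.

For prolongations of products, the maximal ideal of `W` is nilpotent, so Taylor expansion writes a
smooth `H(v, x)` modulo the ideal as a finite sum `∑ pₖ(v) hₖ(x)`. Hence the jet of `v ↦ χ(f v, g
v)` is computed from iterated jets in separate variables (`WeilAlgebra.jet_diag`), and one has to
prolong a function on `X × Y` smoothly in one variable (`partialProlong_mem_functions`). This uses
the weighted sums again, since they commute with jets. -/

noncomputable section

/-! ### Interpolation of derivatives -/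

namespace SmoothCurve

open MeasureTheory intervalIntegral

variable {v : ℝ → ℝ}

theorem differentiable_iteratedDeriv (hv : ContDiff ℝ ∞ v) (k : ℕ) :
    Differentiable ℝ (iteratedDeriv k v) :=
  hv.differentiable_iteratedDeriv k (by exact_mod_cast ENat.natCast_lt_top k)

theorem hasDerivAt_iteratedDeriv (hv : ContDiff ℝ ∞ v) (k : ℕ) (t : ℝ) :
    HasDerivAt (iteratedDeriv k v) (iteratedDeriv (k + 1) v t) t := by
  rw [iteratedDeriv_succ]
  exact (differentiable_iteratedDeriv hv k t).hasDerivAt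

theorem continuous_iteratedDeriv (hv : ContDiff ℝ ∞ v) (k : ℕ) :
    Continuous (iteratedDeriv k v) :=
  (differentiable_iteratedDeriv hv k).continuous

theorem iteratedDeriv_eq_zero_of_two_lt (hs : ∀ t, 2 < |t| → v t = 0) (k : ℕ) {t : ℝ}
    (ht : 2 < |t|) : iteratedDeriv k v t = 0 := by
  have h : v =ᶠ[nhds t] fun _ => 0 := by
    filter_upwards [(isOpen_lt continuous_const continuous_abs).mem_nhds ht] with s hs'
    exact hs s hs'
  rw [h.iteratedDeriv_eq, iteratedDeriv_fun_const_zero]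

/-- Repeated integration by parts moves all derivatives to one factor. The boundary terms at `±3`
vanish because these points lie outside the support; absolute values absorb the signs. -/
theorem abs_integral_iteratedDeriv_mul (hv : ContDiff ℝ ∞ v) (hs : ∀ t, 2 < |t| → v t = 0)
    (i : ℕ) : ∀ j, |∫ t in (-3 : ℝ)..3, iteratedDeriv i v t * iteratedDeriv j v t| =
      |∫ t in (-3 : ℝ)..3, v t * iteratedDeriv (i + j) v t| := by
  induction i with
  | zero => intro j; simp
  | succ i ih =>
    intro j
    have h := integral_mul_deriv_eq_deriv_mul (a := -3) (b := 3)
      (u := iteratedDeriv j v) (v := iteratedDeriv i v)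
      (fun t _ => hasDerivAt_iteratedDeriv hv j t) (fun t _ => hasDerivAt_iteratedDeriv hv i t)
      ((continuous_iteratedDeriv hv _).intervalIntegrable _ _)
      ((continuous_iteratedDeriv hv _).intervalIntegrable _ _)
    rw [iteratedDeriv_eq_zero_of_two_lt hs j (t := 3) (by norm_num),
      iteratedDeriv_eq_zero_of_two_lt hs j (t := -3) (by norm_num)] at h
    have h2 := ih (j + 1)
    simp only [mul_comm (iteratedDeriv i v _)] at h2
    simp only [mul_comm (iteratedDeriv (i + 1) v _)]
    rw [h, zero_mul, zero_mul, sub_zero, zero_sub, abs_neg, h2]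
    congr 4
    ext t
    congr 2
    omega

/-- The supremum of a derivative of a compactly supported smooth function is controlled by the
geometric mean of the supremum of the function and of the suprema of higher derivatives. -/
theorem sq_iteratedDeriv_le (hv : ContDiff ℝ ∞ v) (hs : ∀ t, 2 < |t| → v t = 0) {S₀ : ℝ}
    {S : ℕ → ℝ} (h0 : ∀ t, |v t| ≤ S₀) (hS : ∀ m t, |iteratedDeriv m v t| ≤ S m) (k : ℕ) (t : ℝ) :
    iteratedDeriv k v t ^ 2 ≤ 6 * S₀ * (S (2 * k) + S (2 * k + 2)) := by
  have hS0 : 0 ≤ S₀ := (abs_nonneg _).trans (h0 0)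
  have hSm : ∀ m, 0 ≤ S m := fun m => (abs_nonneg _).trans (hS m 0)
  have hc := continuous_iteratedDeriv hv
  -- The `L²` norm costs only one factor of the small quantity `S₀`: integrate by parts `k` times
  -- and bound `v · v⁽²ᵏ⁾` pointwise. The factor `6` is the length of the interval.
  have hL2 : ∀ k, ∫ t in (-3 : ℝ)..3, iteratedDeriv k v t ^ 2 ≤ 6 * S₀ * S (2 * k) := by
    intro k
    have h1 := abs_integral_iteratedDeriv_mul hv hs k k
    have h2 : |∫ t in (-3 : ℝ)..3, v t * iteratedDeriv (k + k) v t| ≤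
        (S₀ * S (2 * k)) * |3 - (-3)| := by
      rw [← Real.norm_eq_abs]
      refine intervalIntegral.norm_integral_le_of_norm_le_const fun t _ => ?_
      rw [Real.norm_eq_abs, abs_mul, two_mul]
      exact mul_le_mul (h0 t) (hS _ t) (abs_nonneg _) hS0
    have h3 : |(3 : ℝ) - (-3)| = 6 := by norm_num
    rw [← h1, h3] at h2
    calc _ = ∫ t in (-3 : ℝ)..3, iteratedDeriv k v t * iteratedDeriv k v t := by simp only [sq]
      _ ≤ _ := le_abs_self _
      _ ≤ _ := h2
      _ = _ := by ring
  by_cases ht : 2 < |t|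
  · rw [iteratedDeriv_eq_zero_of_two_lt hs k ht]
    rw [zero_pow two_ne_zero]
    exact mul_nonneg (mul_nonneg (by norm_num) hS0) (add_nonneg (hSm _) (hSm _))
  have ht' := abs_le.1 (not_lt.1 ht)
  have hd : ∀ s, HasDerivAt (fun s => iteratedDeriv k v s ^ 2)
      (2 * iteratedDeriv k v s * iteratedDeriv (k + 1) v s) s := fun s =>
    ((hasDerivAt_iteratedDeriv hv k s).pow 2).congr_deriv (by simp)
  have hF := integral_eq_sub_of_hasDerivAt (a := -3) (b := t) (fun s _ => hd s)
    (Continuous.intervalIntegrable (by fun_prop (disch := exact hc _)) _ _)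
  rw [iteratedDeriv_eq_zero_of_two_lt hs k (t := -3) (by norm_num)] at hF
  have hi : ∀ a b : ℝ, IntervalIntegrable
      (fun s => iteratedDeriv k v s ^ 2 + iteratedDeriv (k + 1) v s ^ 2) volume a b :=
    fun a b => Continuous.intervalIntegrable (((hc k).pow 2).add ((hc (k + 1)).pow 2)) _ _
  -- One-dimensional Sobolev inequality: write the square as the integral of its derivative from
  -- `-3`, where it vanishes, and use `2ab ≤ a² + b²`.
  calc iteratedDeriv k v t ^ 2
      = ∫ s in (-3 : ℝ)..t, 2 * iteratedDeriv k v s * iteratedDeriv (k + 1) v s := by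
        rw [hF]; ring
    _ ≤ ∫ s in (-3 : ℝ)..t, (iteratedDeriv k v s ^ 2 + iteratedDeriv (k + 1) v s ^ 2) := by
        refine integral_mono_on (by linarith) (Continuous.intervalIntegrable
          ((continuous_const.mul (hc k)).mul (hc (k + 1))) _ _) (hi _ _) fun s _ => ?_
        nlinarith [sq_nonneg (iteratedDeriv k v s - iteratedDeriv (k + 1) v s)]
    _ ≤ ∫ s in (-3 : ℝ)..3, (iteratedDeriv k v s ^ 2 + iteratedDeriv (k + 1) v s ^ 2) := by
        refine integral_mono_interval le_rfl (by linarith) (by linarith) ?_ (hi _ _)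
        exact Filter.Eventually.of_forall fun s => by positivity
    _ = (∫ s in (-3 : ℝ)..3, iteratedDeriv k v s ^ 2) +
          ∫ s in (-3 : ℝ)..3, iteratedDeriv (k + 1) v s ^ 2 :=
        integral_add (((hc k).pow 2).intervalIntegrable _ _)
          (((hc (k + 1)).pow 2).intervalIntegrable _ _)
    _ ≤ _ := by
        have := hL2 k; have := hL2 (k + 1)
        rw [show 2 * (k + 1) = 2 * k + 2 by ring] at this
        linarith

/-- A compactly supported smooth function of size `η²` all of whose derivatives are of size `η⁻²` has
derivatives of size `η`. -/
theorem exists_abs_iteratedDeriv_le_mul (C₀ : ℝ) (C : ℕ → ℝ) : ∃ K : ℕ → ℝ, ∀ (v : ℝ → ℝ) (η : ℝ),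
    0 < η → ContDiff ℝ ∞ v → (∀ t, 2 < |t| → v t = 0) → (∀ t, |v t| ≤ C₀ * η ^ 2) →
    (∀ m t, |iteratedDeriv m v t| ≤ C m / η ^ 2) →
    ∀ k t, |iteratedDeriv k v t| ≤ K k * η := by
  -- The inequality is applied twice. In the first round the powers of `η` cancel and every
  -- derivative is bounded by `√(T m)`, uniformly in `η`; in the second these bounds replace `C m /
  -- η²` and leave a factor `η²` under the root.
  let T : ℕ → ℝ := fun m => 6 * C₀ * (C (2 * m) + C (2 * m + 2))
  refine ⟨fun k => √(6 * C₀ * (√(T (2 * k)) + √(T (2 * k + 2)))), ?_⟩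
  intro v η hη hv hs h0 hm k t
  have hη2 : 0 < η ^ 2 := by positivity
  have hC0 : 0 ≤ C₀ := by
    have := (abs_nonneg _).trans (h0 0)
    exact nonneg_of_mul_nonneg_left this hη2
  have h1 : ∀ m t, |iteratedDeriv m v t| ≤ √(T m) := fun m t => by
    refine Real.abs_le_sqrt ((sq_iteratedDeriv_le hv hs h0 hm m t).trans (le_of_eq ?_))
    simp only [T]
    field_simp
  have h2 := sq_iteratedDeriv_le hv hs h0 h1 k t
  have h3 : 6 * (C₀ * η ^ 2) * (√(T (2 * k)) + √(T (2 * k + 2))) =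
      (6 * C₀ * (√(T (2 * k)) + √(T (2 * k + 2)))) * η ^ 2 := by ring
  rw [h3] at h2
  have h4 := Real.abs_le_sqrt h2
  rwa [Real.sqrt_mul' _ hη2.le, Real.sqrt_sq hη.le] at h4

end SmoothCurve

section LocallyBounded

open Filter Topology

/-! ### Functions with locally bounded pure directional derivatives -/

theorem ContDiff.along {E : Type*} [NormedAddCommGroup E] [NormedSpace ℝ E] {f : E → ℝ}
    (hf : ContDiff ℝ ∞ f) (x e : E) : ContDiff ℝ ∞ (fun t : ℝ => f (x + t • e)) :=
  hf.comp (contDiff_const.add (contDiff_id.smul contDiff_const))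

/-- A smooth cutoff function on `ℝ`, equal to `1` on `[-1, 1]` and to `0` outside of `[-2, 2]`. -/
def cutoff : ContDiffBump (0 : ℝ) := ⟨1, 2, one_pos, one_lt_two⟩

theorem cutoff_eq_zero {t : ℝ} (ht : 2 ≤ |t|) : cutoff t = 0 :=
  cutoff.zero_of_le_dist (by simpa [Real.dist_eq, cutoff] using ht)

theorem cutoff_eq_one {t : ℝ} (ht : |t| ≤ 1) : cutoff t = 1 :=
  cutoff.one_of_mem_closedBall (by simpa [Real.dist_eq, cutoff] using ht)

theorem cutoff_contDiff : ContDiff ℝ ∞ cutoff := cutoff.contDiff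

theorem exists_iteratedDeriv_cutoff_le (m : ℕ) : ∃ C, ∀ t, |iteratedDeriv m cutoff t| ≤ C := by
  have hc := SmoothCurve.continuous_iteratedDeriv cutoff_contDiff m
  obtain ⟨C, hC⟩ := (isCompact_Icc (a := (-2 : ℝ)) (b := 2)).exists_bound_of_continuousOn
    hc.continuousOn
  refine ⟨max C 0, fun t => ?_⟩
  by_cases ht : 2 < |t|
  · rw [SmoothCurve.iteratedDeriv_eq_zero_of_two_lt (fun t ht => cutoff_eq_zero ht.le) m ht]
    simp
  · exact (hC t (abs_le.1 (not_lt.1 ht))).trans (le_max_left _ _)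

/-- By the Leibniz rule. The point is that `B` depends on `A` only, not on `g`. -/
theorem exists_iteratedDeriv_cutoff_mul_le (A : ℕ → ℝ) : ∃ B : ℕ → ℝ, ∀ g : ℝ → ℝ,
    ContDiff ℝ ∞ g → (∀ p t, |t| ≤ 2 → |iteratedDeriv p g t| ≤ A p) →
    ∀ m t, |iteratedDeriv m (fun t => cutoff t * g t) t| ≤ B m := by
  choose Q hQ using exists_iteratedDeriv_cutoff_le
  have hQ0 : ∀ m, 0 ≤ Q m := fun m => (abs_nonneg _).trans (hQ m 0)
  refine ⟨fun m => ∑ i ∈ Finset.range (m + 1), m.choose i * Q i * A (m - i),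
    fun g hg hA m t => ?_⟩
  have hA0 : ∀ m, 0 ≤ A m := fun m => (abs_nonneg _).trans (hA m 0 (by simp))
  by_cases ht : 2 < |t|
  · rw [SmoothCurve.iteratedDeriv_eq_zero_of_two_lt
      (fun t ht => by simp [cutoff_eq_zero ht.le]) m ht, abs_zero]
    exact Finset.sum_nonneg fun i _ => mul_nonneg (mul_nonneg (Nat.cast_nonneg _) (hQ0 _)) (hA0 _)
  have hm : ((m : ℕ∞) : WithTop ℕ∞) ≤ ∞ := by exact_mod_cast le_top
  have h := iteratedDeriv_mul (n := m) (x := t) (f := (cutoff : ℝ → ℝ)) (g := g)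
    (cutoff_contDiff.of_le hm).contDiffAt (hg.of_le hm).contDiffAt
  have h' : iteratedDeriv m (fun t => cutoff t * g t) t = iteratedDeriv m ((cutoff : ℝ → ℝ) * g) t := rfl
  rw [h', h]
  refine (Finset.abs_sum_le_sum_abs _ _).trans (Finset.sum_le_sum fun i _ => ?_)
  rw [abs_mul, abs_mul, Nat.abs_cast]
  gcongr
  · exact mul_nonneg (Nat.cast_nonneg _) (hQ0 i)
  · exact hQ i t
  · exact hA _ t (not_lt.1 ht)

/-- First order Taylor estimate, from two uses of the mean value inequality; the sharper constant `A
/ 2` is not needed. -/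
theorem abs_sub_sub_mul_deriv_le {g : ℝ → ℝ} (hg : ContDiff ℝ ∞ g) {A : ℝ}
    (hA : ∀ s ∈ Set.Icc (0 : ℝ) 1, |iteratedDeriv 2 g s| ≤ A) {s : ℝ} (hs : s ∈ Set.Icc (0 : ℝ) 1) :
    |g s - g 0 - s * deriv g 0| ≤ A * s ^ 2 := by
  have hd := SmoothCurve.hasDerivAt_iteratedDeriv hg
  have hA0 : 0 ≤ A := (abs_nonneg _).trans (hA 0 (by simp))
  have h1 : ∀ r ∈ Set.Icc (0 : ℝ) s, |deriv g r - deriv g 0| ≤ A * s := fun r hr => by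
    have := (convex_Icc (0 : ℝ) s).norm_image_sub_le_of_norm_hasDerivWithin_le
      (f := deriv g) (f' := iteratedDeriv 2 g) (C := A) (x := 0) (y := r)
      (fun x _ => by
        have := (hd 1 x).hasDerivWithinAt (s := Set.Icc (0 : ℝ) s)
        simpa only [iteratedDeriv_one] using this)
      (fun x hx => hA x ⟨hx.1, hx.2.trans hs.2⟩) ⟨le_rfl, hs.1⟩ hr
    rw [Real.norm_eq_abs, Real.norm_eq_abs, sub_zero, abs_of_nonneg hr.1] at this
    exact this.trans (mul_le_mul_of_nonneg_left hr.2 hA0)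
  have h2 := (convex_Icc (0 : ℝ) s).norm_image_sub_le_of_norm_hasDerivWithin_le
      (f := fun r => g r - r * deriv g 0) (f' := fun r => deriv g r - deriv g 0) (C := A * s)
      (x := 0) (y := s)
      (fun x _ => by
        have h3 := hd 0 x
        simp only [iteratedDeriv_zero, zero_add, iteratedDeriv_one] at h3
        have h4 := (hasDerivAt_id x).mul_const (deriv g 0)
        rw [one_mul] at h4
        exact (h3.sub h4).hasDerivWithinAt)
      (fun x hx => h1 x hx) ⟨le_rfl, hs.1⟩ ⟨hs.1, le_rfl⟩
  simp only [Real.norm_eq_abs, sub_zero, zero_mul, abs_of_nonneg hs.1] at h2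
  rw [show g s - g 0 - s * deriv g 0 = g s - s * deriv g 0 - g 0 by ring]
  exact h2.trans (le_of_eq (by ring))

/-- If the pure partial derivatives of a function of two variables are bounded, then its first
partial derivative in the first variable is a smooth function of the second variable, with
quantitative bounds. -/
theorem exists_contDiffAt_deriv_of_bounds (A : ℕ → ℝ) : ∃ B : ℕ → ℝ, ∀ F : ℝ → ℝ → ℝ,
    (∀ t, ContDiff ℝ ∞ fun s => F s t) → (∀ s, ContDiff ℝ ∞ (F s)) →
    (∀ p, ∀ s ∈ Set.Icc (0 : ℝ) 1, ∀ t, |t| ≤ 2 → |iteratedDeriv p (F s) t| ≤ A p) →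
    (∀ s ∈ Set.Icc (0 : ℝ) 1, ∀ t, |t| ≤ 2 → |iteratedDeriv 2 (fun s => F s t) s| ≤ A 2) →
    ContDiffAt ℝ ∞ (fun t => deriv (fun s => F s t) 0) 0 ∧
      ∀ k, |iteratedDeriv k (fun t => deriv (fun s => F s t) 0) 0| ≤ B k := by
  obtain ⟨A', hA'⟩ := exists_iteratedDeriv_cutoff_mul_le A
  obtain ⟨K, hK⟩ := SmoothCurve.exists_abs_iteratedDeriv_le_mul (2 * A 2) (fun m => 10 * A' m)
  refine ⟨fun k => 2 * A' k + K k * 2, fun F hF1 hF2 hb1 hb2 => ?_⟩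
  set a : ℝ → ℝ := fun t => deriv (fun s => F s t) 0 with ha
  -- The step sizes `σ n` of the difference quotients are squares of a summable sequence, because
  -- interpolation turns `η²` into `η`.
  let η : ℕ → ℝ := fun n => (1 / 2) ^ n
  let σ : ℕ → ℝ := fun n => η n ^ 2
  have hη0 : ∀ n, 0 < η n := fun n => by positivity
  have hη1 : ∀ n, η n ≤ 1 := fun n => pow_le_one₀ (by norm_num) (by norm_num)
  have hσ0 : ∀ n, 0 < σ n := fun n => pow_pos (hη0 n) 2
  have hσ1 : ∀ n, σ n ≤ 1 := fun n => pow_le_one₀ (hη0 n).le (hη1 n)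
  have hσs : ∀ n, σ (n + 1) = σ n / 4 := fun n => by simp only [σ, η]; ring
  have hσm : ∀ n, σ n ∈ Set.Icc (0 : ℝ) 1 := fun n => ⟨(hσ0 n).le, hσ1 n⟩
  have h0m : (0 : ℝ) ∈ Set.Icc (0 : ℝ) 1 := by simp
  let G : ℝ → ℝ → ℝ := fun s t => cutoff t * F s t
  have hG : ∀ s, ContDiff ℝ ∞ (G s) := fun s => cutoff_contDiff.mul (hF2 s)
  have hGb : ∀ s ∈ Set.Icc (0 : ℝ) 1, ∀ m t, |iteratedDeriv m (G s) t| ≤ A' m := fun s hs =>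
    hA' (F s) (hF2 s) fun p t ht => hb1 p s hs t ht
  have hm : ∀ m : ℕ, ((m : ℕ∞) : WithTop ℕ∞) ≤ ∞ := fun m => by exact_mod_cast le_top
  -- Localized difference quotients in `s`: they approach `cutoff · a` at rate `σ n`, while their
  -- derivatives in `t` may grow like `1 / σ n`.
  let D : ℕ → ℝ → ℝ := fun n t => (σ n)⁻¹ * (G (σ n) t - G 0 t)
  have hD : ∀ n, ContDiff ℝ ∞ (D n) := fun n => contDiff_const.mul ((hG _).sub (hG _))
  have hDb : ∀ n m t, |iteratedDeriv m (D n) t| ≤ 2 * A' m / σ n := fun n m t => by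
    have h1 : iteratedDeriv m (D n) t =
        (σ n)⁻¹ * (iteratedDeriv m (G (σ n)) t - iteratedDeriv m (G 0) t) := by
      have h2 : iteratedDeriv m (D n) t =
          iteratedDeriv m (fun t => (σ n)⁻¹ * (G (σ n) - G 0) t) t := rfl
      rw [h2, iteratedDeriv_const_mul_field,
        iteratedDeriv_sub ((hG _).of_le (hm m)).contDiffAt ((hG _).of_le (hm m)).contDiffAt]
    rw [h1, abs_mul, abs_of_pos (inv_pos.2 (hσ0 n)), mul_comm, ← div_eq_mul_inv]
    refine div_le_div_of_nonneg_right ?_ (hσ0 n).le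
    have h3 := hGb (σ n) (hσm n) m t
    have h4 := hGb 0 h0m m t
    exact (abs_sub _ _).trans (by linarith)
  have hDa : ∀ n t, |D n t - cutoff t * a t| ≤ A 2 * σ n := fun n t => by
    by_cases ht : |t| ≤ 2
    · have h1 := abs_sub_sub_mul_deriv_le (hF1 t) (fun s hs => hb2 s hs t ht) (hσm n)
      have h2 : D n t - cutoff t * a t =
          cutoff t * (σ n)⁻¹ * (F (σ n) t - F 0 t - σ n * a t) := by
        have := (hσ0 n).ne'
        simp only [D, G]
        field_simp
      rw [h2, abs_mul, abs_mul, abs_of_nonneg cutoff.nonneg, abs_of_pos (inv_pos.2 (hσ0 n))]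
      have h4 : (σ n)⁻¹ * (A 2 * σ n ^ 2) = A 2 * σ n := by
        have := (hσ0 n).ne'
        field_simp
      rw [← h4, mul_assoc]
      refine (mul_le_of_le_one_left (by positivity) cutoff.le_one).trans ?_
      exact mul_le_mul_of_nonneg_left h1 (inv_pos.2 (hσ0 n)).le
    · have hA2 : 0 ≤ A 2 := (abs_nonneg _).trans (hb2 0 h0m 0 (by simp))
      have h1 := cutoff_eq_zero (not_le.1 ht).le
      simp only [D, G, h1, zero_mul, sub_zero, mul_zero, abs_zero]
      exact mul_nonneg hA2 (hσ0 n).le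
  -- The telescoping differences have size at most `2 A₂ σ n` and `m`-th derivatives at most `(2 +
  -- 8) A'ₘ / σ n`, because `σ (n + 1) = σ n / 4`. Interpolation makes every derivative `O(η n)`, so
  -- the telescoping series converges with all derivatives.
  let w : ℕ → ℝ → ℝ := fun n t => D n t - D (n + 1) t
  have hw : ∀ n, ContDiff ℝ ∞ (w n) := fun n => (hD n).sub (hD (n + 1))
  have hwb : ∀ k n t, |iteratedDeriv k (w n) t| ≤ K k * η n := fun k n t => by
    refine hK (w n) (η n) (hη0 n) (hw n) (fun t ht => ?_) (fun t => ?_) (fun m t => ?_) k t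
    · simp [w, D, G, cutoff_eq_zero ht.le]
    · have h1 := hDa n t
      have h2 := hDa (n + 1) t
      rw [abs_sub_comm] at h2
      have h3 := abs_sub_le (D n t) (cutoff t * a t) (D (n + 1) t)
      have hA2 : 0 ≤ A 2 := (abs_nonneg _).trans (hb2 0 h0m 0 (by simp))
      rw [hσs] at h2
      change _ ≤ 2 * A 2 * σ n
      have := mul_nonneg hA2 (hσ0 n).le
      change |D n t - D (n + 1) t| ≤ _
      linarith
    · have h1 := hDb n m t
      have h2 := hDb (n + 1) m t
      have h3 : iteratedDeriv m (w n) t = iteratedDeriv m (D n) t - iteratedDeriv m (D (n + 1)) t :=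
        iteratedDeriv_sub ((hD _).of_le (hm m)).contDiffAt ((hD _).of_le (hm m)).contDiffAt
      rw [h3]
      refine (abs_sub _ _).trans ((add_le_add h1 h2).trans (le_of_eq ?_))
      rw [hσs]
      have := (hσ0 n).ne'
      change _ = 10 * A' m / σ n
      field_simp
      ring
  have hηs : Summable η := summable_geometric_two
  have hη2 : ∑' n, η n = 2 := tsum_geometric_two
  have hsum : ∀ t, HasSum (fun n => w n t) (D 0 t - cutoff t * a t) := fun t => by
    have h1 : Summable fun n => w n t := Summable.of_norm_bounded (hηs.mul_left (K 0)) fun n => by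
      simpa using hwb 0 n t
    refine (h1.hasSum_iff_tendsto_nat).2 ?_
    have h2 : ∀ N, ∑ n ∈ Finset.range N, w n t = D 0 t - D N t := fun N =>
      Finset.sum_range_sub' (fun n => D n t) N
    simp only [h2]
    refine tendsto_const_nhds.sub ?_
    rw [tendsto_iff_dist_tendsto_zero]
    have hσ : Tendsto (fun n => A 2 * σ n) atTop (𝓝 0) := by
      have h3 : Tendsto η atTop (𝓝 0) := tendsto_pow_atTop_nhds_zero_of_lt_one (by norm_num)
        (by norm_num)
      simpa using (h3.pow 2).const_mul (A 2)
    exact squeeze_zero (fun _ => dist_nonneg) (fun n => hDa n t) hσ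
  have hwF : ∀ (k n : ℕ) (t : ℝ), ‖iteratedFDeriv ℝ k (w n) t‖ ≤ K k * η n := fun k n t => by
    rw [norm_iteratedFDeriv_eq_norm_iteratedDeriv]
    exact hwb k n t
  have hT : ContDiff ℝ ∞ fun t => ∑' n, w n t :=
    contDiff_tsum (N := ⊤) (v := fun k n => K k * η n) hw (fun k _ => hηs.mul_left _)
      fun k n t _ => hwF k n t
  have hTb : ∀ k t, |iteratedDeriv k (fun t => ∑' n, w n t) t| ≤ K k * 2 := fun k t => by
    have h1 := iteratedFDeriv_tsum_apply (N := ⊤) (v := fun k n => K k * η n) hw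
      (fun k _ => hηs.mul_left _) (fun k n t _ => hwF k n t) (k := k) le_top t
    have h2 := norm_iteratedFDeriv_eq_norm_iteratedDeriv (𝕜 := ℝ) (n := k)
      (f := fun t => ∑' n, w n t) (x := t)
    rw [← Real.norm_eq_abs, ← h2, h1, ← hη2]
    exact tsum_of_norm_bounded (hηs.hasSum.mul_left _) fun n => hwF k n t
  have heq : (fun t => cutoff t * a t) = D 0 - fun t => ∑' n, w n t := by
    ext t
    simp [(hsum t).tsum_eq]
  have hev : a =ᶠ[𝓝 0] D 0 - fun t => ∑' n, w n t := by
    rw [← heq]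
    filter_upwards [Metric.ball_mem_nhds (0 : ℝ) one_pos] with t ht
    rw [cutoff_eq_one (by simpa using (Metric.mem_ball.1 ht).le), one_mul]
  refine ⟨((hD 0).sub hT).contDiffAt.congr_of_eventuallyEq hev, fun k => ?_⟩
  rw [hev.iteratedDeriv_eq,
    iteratedDeriv_sub ((hD _).of_le (hm k)).contDiffAt (hT.of_le (hm k)).contDiffAt]
  refine (abs_sub _ _).trans (add_le_add ?_ (hTb k 0))
  have := hDb 0 k 0
  simpa [σ, η] using this

/-! ### Smoothness from bounds along the vectors of a basis -/

section Tame

variable {E : Type*} [NormedAddCommGroup E] [NormedSpace ℝ E]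

/-- The derivative of a function in the direction `e`. -/
def dirDeriv (e : E) (f : E → ℝ) (x : E) : ℝ := deriv (fun t : ℝ => f (x + t • e)) 0

/-- A function is tame in the direction `e` if it is smooth along all lines in this direction, with
locally bounded derivatives. -/
structure TameAlong (f : E → ℝ) (e : E) : Prop where
  smooth : ∀ x, ContDiff ℝ ∞ fun t : ℝ => f (x + t • e)
  bdd : ∀ (p : ℕ) (R : ℝ), ∃ C, ∀ x, ‖x‖ ≤ R → |iteratedDeriv p (fun t : ℝ => f (x + t • e)) 0| ≤ C

/-- Moving the base point along the line is what allows `TameAlong.bdd` to speak of derivatives at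
`0` only. -/
theorem iteratedDeriv_line (f : E → ℝ) (x e : E) (p : ℕ) (s : ℝ) :
    iteratedDeriv p (fun t : ℝ => f (x + t • e)) s =
      iteratedDeriv p (fun t : ℝ => f ((x + s • e) + t • e)) 0 := by
  have h := iteratedDeriv_comp_const_add p (fun t : ℝ => f (x + t • e)) s
  have h2 := congrFun h 0
  simp only [add_zero] at h2
  rw [← h2]
  congr 1
  ext t
  rw [add_smul, add_assoc]

theorem dirDeriv_line (f : E → ℝ) (x e : E) (s : ℝ) :
    dirDeriv e f (x + s • e) = deriv (fun t : ℝ => f (x + t • e)) s := by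
  have := iteratedDeriv_line f x e 1 s
  rw [iteratedDeriv_one, iteratedDeriv_one] at this
  exact this.symm

namespace TameAlong

variable {f : E → ℝ} {e e' : E}

theorem dirDeriv_self (hf : TameAlong f e) : TameAlong (dirDeriv e f) e where
  smooth x := by
    have h1 := contDiff_infty_iff_deriv.1 (hf.smooth x)
    have h2 : (fun t : ℝ => dirDeriv e f (x + t • e)) = deriv fun t : ℝ => f (x + t • e) :=
      funext fun t => dirDeriv_line f x e t
    rw [h2]
    exact h1.2
  bdd p R := by
    obtain ⟨C, hC⟩ := hf.bdd (p + 1) R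
    refine ⟨C, fun x hx => ?_⟩
    have h2 : (fun t : ℝ => dirDeriv e f (x + t • e)) = deriv fun t : ℝ => f (x + t • e) :=
      funext fun t => dirDeriv_line f x e t
    rw [h2, ← iteratedDeriv_succ']
    exact hC x hx

/-- A directional derivative of a function that is tame in two directions is tame in the other
direction. -/
theorem dirDeriv (hf : TameAlong f e) (hf' : TameAlong f e') : TameAlong (dirDeriv e f) e' := by
  have key : ∀ R : ℝ, ∃ B : ℕ → ℝ, ∀ x, ‖x‖ ≤ R →
      ContDiffAt ℝ ∞ (fun t : ℝ => _root_.dirDeriv e f (x + t • e')) 0 ∧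
      ∀ k, |iteratedDeriv k (fun t : ℝ => _root_.dirDeriv e f (x + t • e')) 0| ≤ B k := by
    intro R
    -- The enlarged ball contains all points `x + t • e' + s • e` with `|t| ≤ 2` and `0 ≤ s ≤ 1`.
    choose C hC using fun p => hf.bdd p (R + 2 * ‖e'‖ + ‖e‖)
    choose C' hC' using fun p => hf'.bdd p (R + 2 * ‖e'‖ + ‖e‖)
    obtain ⟨B, hB⟩ := exists_contDiffAt_deriv_of_bounds fun p => max (C p) (C' p)
    refine ⟨B, fun x hx => ?_⟩
    have hnorm : ∀ s ∈ Set.Icc (0 : ℝ) 1, ∀ t : ℝ, |t| ≤ 2 →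
        ‖x + t • e' + s • e‖ ≤ R + 2 * ‖e'‖ + ‖e‖ := fun s hs t ht => by
      refine (norm_add_le _ _).trans (add_le_add ((norm_add_le _ _).trans (add_le_add hx ?_)) ?_)
      · rw [norm_smul]
        exact mul_le_mul_of_nonneg_right ht (norm_nonneg _)
      · rw [norm_smul, Real.norm_eq_abs, abs_of_nonneg hs.1]
        exact mul_le_of_le_one_left (norm_nonneg _) hs.2
    have hcomm : ∀ s : ℝ, (fun t : ℝ => f (x + t • e' + s • e)) =
        fun t : ℝ => f ((x + s • e) + t • e') := fun s => by
      ext t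
      rw [add_right_comm]
    refine hB (fun s t => f (x + t • e' + s • e)) (fun t => hf.smooth _) (fun s => ?_) ?_ ?_
    · rw [hcomm]
      exact hf'.smooth _
    · intro p s hs t ht
      rw [hcomm, iteratedDeriv_line]
      refine (hC' p _ ?_).trans (le_max_right _ _)
      rw [add_right_comm]
      exact hnorm s hs t ht
    · intro s hs t ht
      rw [iteratedDeriv_line]
      exact (hC 2 _ (hnorm s hs t ht)).trans (le_max_left _ _)
  refine ⟨fun x => contDiff_iff_contDiffAt.2 fun t => ?_, fun p R => ?_⟩
  · obtain ⟨B, hB⟩ := key ‖x + t • e'‖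
    have h1 := (hB (x + t • e') le_rfl).1
    have h2 : (fun s : ℝ => _root_.dirDeriv e f (x + s • e')) =
        (fun s : ℝ => _root_.dirDeriv e f ((x + t • e') + s • e')) ∘ fun s => s - t := by
      ext s
      simp only [Function.comp]
      congr 1
      rw [add_assoc, ← add_smul, add_sub_cancel]
    rw [h2]
    refine ContDiffAt.comp t ?_ (by fun_prop)
    rwa [sub_self]
  · obtain ⟨B, hB⟩ := key R
    exact ⟨B p, fun x hx => (hB x hx).2 p⟩

theorem hasDerivAt (hf : TameAlong f e) (x : E) (s : ℝ) :
    HasDerivAt (fun t : ℝ => f (x + t • e)) (_root_.dirDeriv e f (x + s • e)) s := by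
  rw [dirDeriv_line]
  exact ((hf.smooth x).differentiable (by simp)).differentiableAt.hasDerivAt

/-- The mean value theorem for tame functions. -/
theorem exists_sub_eq (hf : TameAlong f e) (x : E) (c : ℝ) :
    ∃ θ : ℝ, |θ| ≤ |c| ∧ f (x + c • e) - f x = c * _root_.dirDeriv e f (x + θ • e) := by
  -- Rescaling to the interval `[0, 1]` treats all signs of `c` at once.
  have hd : ∀ s, HasDerivAt (fun s : ℝ => f (x + (s * c) • e))
      (_root_.dirDeriv e f (x + (s * c) • e) * c) s := fun s => by
    have := (hf.hasDerivAt x (s * c)).comp s ((hasDerivAt_id s).mul_const c)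
    simpa [Function.comp_def] using this
  obtain ⟨s, hs, hs'⟩ := exists_hasDerivAt_eq_slope _ _ (zero_lt_one' ℝ)
    (fun s _ => (hd s).continuousAt.continuousWithinAt) fun s _ => hd s
  refine ⟨s * c, ?_, ?_⟩
  · rw [abs_mul, abs_of_pos hs.1]
    exact mul_le_of_le_one_left (abs_nonneg _) hs.2.le
  · simp only [one_mul, zero_mul, zero_smul, add_zero, sub_zero, div_one] at hs'
    rw [← hs', mul_comm]

end TameAlong

variable {ι : Type*} (b : Module.Basis ι ℝ E)

theorem tendsto_sum_repr [FiniteDimensional ℝ E] (x : E) (s : Finset ι) :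
    Tendsto (fun y : E => x + ∑ i ∈ s, b.repr y i • b i) (𝓝 0) (𝓝 x) := by
  have : Continuous fun y : E => x + ∑ i ∈ s, b.repr y i • b i :=
    continuous_const.add (continuous_finsetSum _ fun i _ =>
      ((b.coord i).continuous_of_finiteDimensional).smul continuous_const)
  simpa using this.tendsto 0

theorem tendsto_norm_sub_add_abs_repr [FiniteDimensional ℝ E] (x : E) (s : Finset ι) (i : ι) :
    Tendsto (fun y : E => ‖x + ∑ i ∈ s, b.repr y i • b i - x‖ + |b.repr y i| * ‖b i‖) (𝓝 0)
      (𝓝 0) := by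
  have h1 := ((tendsto_sum_repr b x s).sub_const x).norm
  have h2 : Continuous fun y : E => |b.repr y i| * ‖b i‖ :=
    ((b.coord i).continuous_of_finiteDimensional).abs.mul continuous_const
  simpa using h1.add (h2.tendsto 0)

variable [Fintype ι]

/-- Walk from `x` to a nearby point one coordinate at a time. Each leg changes `f` by at most a
local bound for the directional derivative times the coordinate, so no continuity of the derivative
is required. -/
theorem continuous_of_tameAlong_basis [FiniteDimensional ℝ E] {f : E → ℝ}
    (hf : ∀ i, TameAlong f (b i)) : Continuous f := by
  classical
  rw [continuous_iff_continuousAt]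
  intro x
  have main : ∀ s : Finset ι,
      Tendsto (fun y : E => f (x + ∑ i ∈ s, b.repr y i • b i)) (𝓝 0) (𝓝 (f x)) := by
    intro s
    induction s using Finset.induction_on with
    | empty => simp
    | insert i s hi ih =>
      obtain ⟨C, hC⟩ := (hf i).dirDeriv_self.bdd 0 (‖x‖ + 1)
      have h0 : Tendsto (fun y : E => C * |b.repr y i|) (𝓝 0) (𝓝 0) := by
        have h2 : Continuous fun y : E => C * |b.repr y i| :=
          continuous_const.mul ((b.coord i).continuous_of_finiteDimensional).abs
        simpa using h2.tendsto 0
      have h1 := h0.add (tendsto_iff_norm_sub_tendsto_zero.1 ih)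
      rw [add_zero] at h1
      refine tendsto_iff_norm_sub_tendsto_zero.2
        (squeeze_zero' (Eventually.of_forall fun _ => norm_nonneg _) ?_ h1)
      filter_upwards [(tendsto_norm_sub_add_abs_repr b x s i).eventually_lt_const one_pos] with y hy
      set z := x + ∑ i ∈ s, b.repr y i • b i with hz
      have hz' : x + ∑ i ∈ insert i s, b.repr y i • b i = z + b.repr y i • b i := by
        rw [Finset.sum_insert hi, hz]
        abel
      obtain ⟨θ, hθ, hθ'⟩ := (hf i).exists_sub_eq z (b.repr y i)
      have h3 : |dirDeriv (b i) f (z + θ • b i)| ≤ C := by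
        have h4 := hC (z + θ • b i) (by
          have h5 : z + θ • b i = x + (z - x) + θ • b i := by abel
          rw [h5]
          refine (norm_add₃_le).trans ?_
          rw [norm_smul, Real.norm_eq_abs]
          have := mul_le_mul_of_nonneg_right hθ (norm_nonneg (b i))
          linarith)
        simpa using h4
      rw [hz', Real.norm_eq_abs]
      calc |f (z + b.repr y i • b i) - f x|
          = |b.repr y i * dirDeriv (b i) f (z + θ • b i) + (f z - f x)| := by
            rw [← hθ']
            ring_nf
        _ ≤ |b.repr y i * dirDeriv (b i) f (z + θ • b i)| + |f z - f x| := abs_add_le _ _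
        _ ≤ _ := by
            rw [abs_mul, mul_comm]
            exact add_le_add (mul_le_mul_of_nonneg_right h3 (abs_nonneg _)) le_rfl
  have h := (main Finset.univ).comp (tendsto_sub_nhds_zero_iff.2 (tendsto_id (α := E) (x := 𝓝 x)))
  refine h.congr fun y => ?_
  simp [b.sum_repr]

/-- Continuous partial derivatives imply differentiability. Their continuity comes from
`continuous_of_tameAlong_basis`, since each of them is again tame along the whole basis. -/
theorem hasFDerivAt_of_tameAlong_basis [FiniteDimensional ℝ E] {f : E → ℝ}
    (hf : ∀ i, TameAlong f (b i)) (x : E) :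
    HasFDerivAt f (∑ i, dirDeriv (b i) f x • (b.coord i).toContinuousLinearMap) x := by
  classical
  have main : ∀ s : Finset ι,
      (fun y : E => f (x + ∑ i ∈ s, b.repr y i • b i) - f x -
        ∑ i ∈ s, dirDeriv (b i) f x * b.repr y i) =o[𝓝 0] fun y => y := by
    intro s
    induction s using Finset.induction_on with
    | empty => simp
    | insert i s hi ih =>
      have hcont : Continuous (dirDeriv (b i) f) :=
        continuous_of_tameAlong_basis b fun j => (hf i).dirDeriv (hf j)
      have hO : (fun y : E => b.repr y i) =O[𝓝 0] fun y => y :=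
        (b.coord i).toContinuousLinearMap.isBigO_id _
      have ho : (fun y : E => f (x + ∑ i ∈ insert i s, b.repr y i • b i) -
          f (x + ∑ i ∈ s, b.repr y i • b i) - dirDeriv (b i) f x * b.repr y i) =o[𝓝 0]
          fun y : E => b.repr y i := by
        refine Asymptotics.isLittleO_iff.2 fun ε hε => ?_
        obtain ⟨δ, hδ, hδ'⟩ := Metric.continuousAt_iff.1 hcont.continuousAt ε hε
        filter_upwards [(tendsto_norm_sub_add_abs_repr b x s i).eventually_lt_const hδ] with y hy
        set z := x + ∑ i ∈ s, b.repr y i • b i with hz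
        have hz' : x + ∑ i ∈ insert i s, b.repr y i • b i = z + b.repr y i • b i := by
          rw [Finset.sum_insert hi, hz]
          abel
        obtain ⟨θ, hθ, hθ'⟩ := (hf i).exists_sub_eq z (b.repr y i)
        have h3 : dist (z + θ • b i) x < δ := by
          rw [dist_eq_norm, add_sub_right_comm]
          refine (norm_add_le _ _).trans_lt (lt_of_le_of_lt ?_ hy)
          rw [norm_smul, Real.norm_eq_abs]
          have := mul_le_mul_of_nonneg_right hθ (norm_nonneg (b i))
          linarith
        have h4 := (hδ' h3).le
        rw [hz', hθ', mul_comm, ← sub_mul, norm_mul]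
        exact mul_le_mul_of_nonneg_right h4 (norm_nonneg _)
      refine ((ho.trans_isBigO hO).add ih).congr_left fun y => ?_
      rw [Finset.sum_insert hi, Finset.sum_insert hi]
      ring
  rw [hasFDerivAt_iff_isLittleO_nhds_zero]
  refine (main Finset.univ).congr_left fun y => ?_
  simp [b.sum_repr]

/-- A function on a finite dimensional space that has locally bounded directional derivatives of all
orders along the vectors of a basis is smooth. -/
theorem contDiff_of_tameAlong_basis [FiniteDimensional ℝ E] {f : E → ℝ}
    (hf : ∀ i, TameAlong f (b i)) : ContDiff ℝ ∞ f := by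
  refine contDiff_infty.2 fun N => ?_
  induction N generalizing f with
  | zero => exact contDiff_zero.2 (continuous_of_tameAlong_basis b hf)
  | succ N ih =>
    have hd := hasFDerivAt_of_tameAlong_basis b hf
    rw [Nat.cast_succ, contDiff_succ_iff_fderiv]
    refine ⟨fun x => (hd x).differentiableAt, by simp, ?_⟩
    rw [funext fun x => (hd x).fderiv]
    -- The coefficients of the differential are directional derivatives, tame along the basis, so
    -- the induction hypothesis applies to them.
    exact ContDiff.sum fun i _ => (ih fun j => (hf i).dirDeriv (hf j)).smul contDiff_const

end Tame

/-! ### Boman's theorem -/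

section Boman

theorem exists_iteratedFDeriv_le_of_hasCompactSupport {g : ℝ → ℝ} (hg : ContDiff ℝ ∞ g)
    (hs : HasCompactSupport g) (n : ℕ) :
    ∃ C, ∀ j ≤ n, ∀ t, ‖iteratedFDeriv ℝ j g t‖ ≤ C := by
  have h1 : ∀ j : ℕ, ∃ C, ∀ t, ‖iteratedFDeriv ℝ j g t‖ ≤ C := fun j =>
    (hs.iteratedFDeriv (𝕜 := ℝ) j).exists_bound_of_continuous
      (hg.continuous_iteratedFDeriv (m := j) (by exact_mod_cast le_top))
  choose C hC using h1
  refine ⟨∑ j ∈ Finset.range (n + 1), C j, fun j hj t => (hC j t).trans ?_⟩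
  exact Finset.single_le_sum (f := C) (fun i _ => (norm_nonneg _).trans (hC i 0))
    (Finset.mem_range.2 (Nat.lt_succ_of_le hj))

variable {E : Type*} [NormedAddCommGroup E] [NormedSpace ℝ E]

theorem norm_iteratedFDeriv_smul_const_le {g : ℝ → ℝ} (hg : ContDiff ℝ ∞ g) (a : E) (j : ℕ)
    (t : ℝ) : ‖iteratedFDeriv ℝ j (fun t => g t • a) t‖ ≤ ‖a‖ * ‖iteratedFDeriv ℝ j g t‖ := by
  have h := (ContinuousLinearMap.toSpanSingleton ℝ a).norm_iteratedFDeriv_comp_left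
    (n := j) (hg.contDiffAt (x := t)) (by exact_mod_cast le_top)
  rw [ContinuousLinearMap.norm_toSpanSingleton] at h
  exact h

/-- The bump functions used to join points along a fast converging sequence. -/
def dyadicBump (n : ℕ) : ContDiffBump ((1 / 2 : ℝ) ^ n) :=
  ⟨(1 / 2) ^ n / 8, (1 / 2) ^ n / 4, by positivity,
    div_lt_div_of_pos_left (by positivity) (by norm_num) (by norm_num)⟩

theorem dyadicBump_eq_one {n : ℕ} {t : ℝ} (ht : |t - (1 / 2) ^ n| ≤ (1 / 2) ^ n / 8) :
    dyadicBump n t = 1 :=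
  (dyadicBump n).one_of_mem_closedBall ht

/-- Distinct centres differ by a factor of at least `2`, which keeps the bumps apart. -/
theorem dyadicBump_eq_zero {n m : ℕ} (hmn : m ≠ n) {t : ℝ}
    (ht : |t - (1 / 2) ^ n| ≤ (1 / 2) ^ n / 8) : dyadicBump m t = 0 := by
  refine (dyadicBump m).zero_of_le_dist ?_
  change (1 / 2 : ℝ) ^ m / 4 ≤ |t - (1 / 2) ^ m|
  have ht' := abs_le.1 ht
  have hm : (0 : ℝ) < (1 / 2) ^ m := by positivity
  have hn : (0 : ℝ) < (1 / 2) ^ n := by positivity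
  rcases lt_or_gt_of_ne hmn with h | h
  · have h1 : (1 / 2 : ℝ) ^ n ≤ (1 / 2) ^ (m + 1) :=
      pow_le_pow_of_le_one (by norm_num) (by norm_num) h
    rw [pow_succ] at h1
    rw [abs_sub_comm]
    exact le_trans (by linarith) (le_abs_self _)
  · have h1 : (1 / 2 : ℝ) ^ m ≤ (1 / 2) ^ (n + 1) :=
      pow_le_pow_of_le_one (by norm_num) (by norm_num) h
    rw [pow_succ] at h1
    exact le_trans (by linarith) (le_abs_self _)

/-- There is a sequence of positive numbers such that any sequence of points that converges to `x` at
least as fast can be joined by a smooth curve, which runs in the direction `e` at the given points. -/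
theorem exists_special_curve [CompleteSpace E] (x e : E) : ∃ ε : ℕ → ℝ, (∀ n, 0 < ε n) ∧
    ∀ y : ℕ → E, (∀ n, dist (y n) x ≤ ε n) → ∃ c : ℝ → E, ContDiff ℝ ∞ c ∧
      ∀ n, c =ᶠ[𝓝 ((1 / 2) ^ n)] fun t => y n + (ε n * (t - (1 / 2) ^ n)) • e := by
  let φ : ℕ → ℝ → ℝ := fun n t => dyadicBump n t * (t - (1 / 2) ^ n)
  have hψ : ∀ n, ContDiff ℝ ∞ (dyadicBump n) := fun n => (dyadicBump n).contDiff
  have hφ : ∀ n, ContDiff ℝ ∞ (φ n) := fun n => (hψ n).mul (contDiff_id.sub contDiff_const)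
  choose C hC using fun n => exists_iteratedFDeriv_le_of_hasCompactSupport (hψ n)
    (dyadicBump n).hasCompactSupport n
  choose C' hC' using fun n => exists_iteratedFDeriv_le_of_hasCompactSupport (hφ n)
    ((dyadicBump n).hasCompactSupport.mul_right) n
  have hC0 : ∀ n, 0 ≤ C n := fun n => (norm_nonneg _).trans (hC n 0 (Nat.zero_le _) 0)
  have hC0' : ∀ n, 0 ≤ C' n := fun n => (norm_nonneg _).trans (hC' n 0 (Nat.zero_le _) 0)
  -- `C n` and `C' n` bound the derivatives of order up to `n` of the `n`-th bump and of its product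
  -- with `t - 2⁻ⁿ`. With this `ε`, the `k`-th derivatives of the terms are dominated by `2⁻ⁿ (1 +
  -- ‖e‖)` as soon as `n ≥ k`.
  let ε : ℕ → ℝ := fun n => (1 / 2) ^ n / (1 + C n + C' n)
  have hden : ∀ n, 0 < 1 + C n + C' n := fun n => by linarith [hC0 n, hC0' n]
  have hε : ∀ n, 0 < ε n := fun n => div_pos (by positivity) (hden n)
  have hεm : ∀ n, ε n * (1 + C n + C' n) = (1 / 2) ^ n := fun n => div_mul_cancel₀ _ (hden n).ne'
  refine ⟨ε, hε, fun y hy => ?_⟩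
  let τ : ℕ → ℝ → E := fun n t => dyadicBump n t • (y n - x) + φ n t • (ε n • e)
  have h1 : ∀ n, ContDiff ℝ ∞ fun t => dyadicBump n t • (y n - x) := fun n =>
    (hψ n).smul contDiff_const
  have h2 : ∀ n, ContDiff ℝ ∞ fun t => φ n t • (ε n • e) := fun n => (hφ n).smul contDiff_const
  have hτ : ∀ n, ContDiff ℝ ∞ (τ n) := fun n => (h1 n).add (h2 n)
  have hτb : ∀ (k n : ℕ), k ≤ n → ∀ t,
      ‖iteratedFDeriv ℝ k (τ n) t‖ ≤ (1 / 2) ^ n * (1 + ‖e‖) := fun k n hk t => by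
    have hk' : ((k : ℕ∞) : WithTop ℕ∞) ≤ ∞ := by exact_mod_cast le_top
    have h3 : iteratedFDeriv ℝ k (τ n) t = _ :=
      iteratedFDeriv_add_apply (((h1 n).of_le hk').contDiffAt) (((h2 n).of_le hk').contDiffAt)
    rw [h3]
    refine (norm_add_le _ _).trans ?_
    have h4 := (norm_iteratedFDeriv_smul_const_le (hψ n) (y n - x) k t).trans
      (mul_le_mul ((dist_eq_norm (y n) x).symm.le.trans (hy n)) (hC n k hk t) (norm_nonneg _)
        (hε n).le)
    have h5 := (norm_iteratedFDeriv_smul_const_le (hφ n) (ε n • e) k t).trans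
      (mul_le_mul_of_nonneg_left (hC' n k hk t) (norm_nonneg _))
    rw [norm_smul, Real.norm_eq_abs, abs_of_pos (hε n)] at h5
    refine (add_le_add h4 h5).trans ?_
    rw [← hεm]
    have e1 : ε n * C n ≤ ε n * (1 + C n + C' n) :=
      mul_le_mul_of_nonneg_left (by linarith [hC0' n]) (hε n).le
    have e2 : ε n * ‖e‖ * C' n ≤ ε n * (1 + C n + C' n) * ‖e‖ := by
      rw [mul_right_comm]
      exact mul_le_mul_of_nonneg_right
        (mul_le_mul_of_nonneg_left (by linarith [hC0 n]) (hε n).le) (norm_nonneg _)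
    rw [mul_add, mul_one]
    exact add_le_add e1 e2
  refine ⟨fun t => x + ∑' n, τ n t, contDiff_const.add ?_, fun n => ?_⟩
  · refine contDiff_tsum_of_eventually (N := ⊤) (v := fun _ n => (1 / 2) ^ n * (1 + ‖e‖)) hτ
      (fun k _ => summable_geometric_two.mul_right _) fun k _ => ?_
    rw [Nat.cofinite_eq_atTop]
    filter_upwards [eventually_ge_atTop k] with n hn t using hτb k n hn t
  · have hpos : (0 : ℝ) < (1 / 2) ^ n / 8 := by positivity
    filter_upwards [Metric.closedBall_mem_nhds ((1 / 2 : ℝ) ^ n) hpos] with t ht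
    have ht' : |t - (1 / 2) ^ n| ≤ (1 / 2) ^ n / 8 := ht
    rw [tsum_eq_single n fun m hm => by simp [τ, φ, dyadicBump_eq_zero hm ht']]
    simp only [τ, φ, dyadicBump_eq_one ht', one_smul, one_mul, smul_smul, mul_comm (ε n)]
    abel

/-- The directional derivatives of a function that is smooth along smooth curves are locally
bounded. -/
theorem tameAlong_of_smooth_along_curves [FiniteDimensional ℝ E] {f : E → ℝ}
    (hf : ∀ c : ℝ → E, ContDiff ℝ ∞ c → ContDiff ℝ ∞ fun t => f (c t)) (e : E) :
    TameAlong f e := by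
  have hl : ∀ x, ContDiff ℝ ∞ fun t : ℝ => f (x + t • e) := fun x =>
    hf _ (contDiff_const.add (contDiff_id.smul contDiff_const))
  refine ⟨hl, fun p R => ?_⟩
  set g : E → ℝ := fun x => iteratedDeriv p (fun t : ℝ => f (x + t • e)) 0 with hg
  suffices h : ∃ C, ∀ x ∈ Metric.closedBall (0 : E) R, |g x| ≤ C by simpa using h
  have := FiniteDimensional.proper ℝ E
  -- By compactness it suffices to bound `g` near each point `x` of the ball.
  refine (isCompact_closedBall (0 : E) R).induction_on (p := fun s => ∃ C, ∀ x ∈ s, |g x| ≤ C)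
    (by simp) (fun s t hst ⟨C, hC⟩ => ⟨C, fun x hx => hC x (hst hx)⟩)
    (fun s t ⟨C, hC⟩ ⟨C', hC'⟩ => ⟨max C C', fun x hx => hx.elim
      (fun h => (hC x h).trans (le_max_left _ _)) fun h => (hC' x h).trans (le_max_right _ _)⟩)
    fun x _ => ?_
  by_contra hcon
  have := FiniteDimensional.complete ℝ E
  obtain ⟨ε, hε, hc⟩ := exists_special_curve x e
  -- If `g` is unbounded near `x`, its growth can outrun the slow speed `ε n` of the special curve,
  -- whose `p`-th power appears in the chain rule. Then the `p`-th derivative of `f ∘ c` at `2⁻ⁿ`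
  -- exceeds `n`, impossible on `[0, 1]`.
  have hy : ∀ n : ℕ, ∃ y, dist y x ≤ ε n ∧ n / ε n ^ p < |g y| := fun n => by
    by_contra h
    push Not at h
    exact hcon ⟨Metric.closedBall x (ε n),
      mem_nhdsWithin_of_mem_nhds (Metric.closedBall_mem_nhds x (hε n)), n / ε n ^ p,
      fun y hy => h y hy⟩
  choose y hy1 hy2 using hy
  obtain ⟨c, hc1, hc2⟩ := hc y hy1
  obtain ⟨C, hC⟩ := (isCompact_Icc (a := (0 : ℝ)) (b := 1)).exists_bound_of_continuousOn
    (SmoothCurve.continuous_iteratedDeriv (hf c hc1) p).continuousOn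
  obtain ⟨n, hn⟩ := exists_nat_gt C
  have h1 := hC ((1 / 2) ^ n) ⟨by positivity, pow_le_one₀ (by norm_num) (by norm_num)⟩
  have h2 : (fun t => f (c t)) =ᶠ[𝓝 ((1 / 2) ^ n)]
      fun t => f (y n + (ε n * (t - (1 / 2) ^ n)) • e) := (hc2 n).fun_comp f
  have h3 : iteratedDeriv p (fun t => f (y n + (ε n * (t - (1 / 2) ^ n)) • e)) ((1 / 2) ^ n) =
      ε n ^ p * g (y n) := by
    rw [iteratedDeriv_comp_sub_const p (fun t => f (y n + (ε n * t) • e)),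
      iteratedDeriv_comp_const_mul (f := fun t : ℝ => f (y n + t • e))
        ((hl (y n)).of_le (by exact_mod_cast le_top)) (ε n)]
    simp [hg]
  rw [h2.iteratedDeriv_eq, h3, Real.norm_eq_abs, abs_mul, abs_of_pos (pow_pos (hε n) p)] at h1
  have h4 := hy2 n
  rw [div_lt_iff₀' (pow_pos (hε n) p)] at h4
  linarith

/-- Boman's theorem: a function on a finite dimensional space is smooth if it is smooth along smooth
curves. -/
theorem contDiff_of_smooth_along_curves [FiniteDimensional ℝ E] {f : E → ℝ}
    (hf : ∀ c : ℝ → E, ContDiff ℝ ∞ c → ContDiff ℝ ∞ fun t => f (c t)) : ContDiff ℝ ∞ f :=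
  contDiff_of_tameAlong_basis (Module.finBasis ℝ E) fun _ => tameAlong_of_smooth_along_curves hf _

end Boman

/-! ### Weak smoothness of families of smooth curves -/

/-- The space of absolutely summable families of reals indexed by `[-R, R]`. -/
abbrev Weights (R : ℝ) : Type := lp (fun _ : Set.Icc (-R) R => ℝ) 1

namespace Weights

variable {R : ℝ}

theorem summable_abs (w : Weights R) : Summable fun u => |w u| := by
  simpa using (lp.memℓp w).summable (by simp)

theorem summable_mul (w : Weights R) {b : Set.Icc (-R) R → ℝ} {B : ℝ} (hb : ∀ u, |b u| ≤ B) :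
    Summable fun u => w u * b u :=
  Summable.of_norm_bounded (w.summable_abs.mul_right B) fun u => by
    rw [norm_mul]
    exact mul_le_mul_of_nonneg_left (hb u) (norm_nonneg _)

/-- The functional given by a bounded family. -/
def pairing (b : Set.Icc (-R) R → ℝ) (B : ℝ) (hb : ∀ u, |b u| ≤ B) : Weights R →L[ℝ] ℝ :=
  LinearMap.mkContinuous
    { toFun := fun w => ∑' u, w u * b u
      map_add' := fun w w' => by
        rw [← (w.summable_mul hb).tsum_add (w'.summable_mul hb)]
        exact tsum_congr fun u => by simp [add_mul]
      map_smul' := fun r w => by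
        rw [RingHom.id_apply, smul_eq_mul, ← tsum_mul_left]
        exact tsum_congr fun u => by simp [mul_assoc] } B fun w => by
    have h1 : ‖w‖ = ∑' u, |w u| := by
      rw [lp.norm_eq_tsum_rpow (by simp)]
      simp
    rw [h1, mul_comm]
    exact tsum_of_norm_bounded (w.summable_abs.hasSum.mul_right B) fun u => by
      rw [norm_mul]
      exact mul_le_mul_of_nonneg_left (hb u) (norm_nonneg _)

/-- The Dirac weight. -/
def dirac (u : Set.Icc (-R) R) : Weights R := by
  classical
  exact lp.single 1 u 1

theorem norm_dirac (u : Set.Icc (-R) R) : ‖dirac u‖ = 1 := by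
  classical
  simp [dirac]

theorem tsum_dirac_mul (u : Set.Icc (-R) R) (b : Set.Icc (-R) R → ℝ) :
    ∑' s, dirac u s * b s = b u := by
  classical
  rw [tsum_eq_single u fun s hs => by simp [dirac, hs]]
  simp [dirac]

end Weights

/-- The functional `g ↦ ∑ wᵤ g⁽ᵖ⁾(u)` on smooth functions of one variable. -/
def weightedSum {R : ℝ} (p : ℕ) (w : Weights R) (g : ℝ → ℝ) : ℝ :=
  ∑' u, w u * iteratedDeriv p g u

theorem exists_abs_le_of_continuous {R : ℝ} {g : ℝ → ℝ} (hg : Continuous g) :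
    ∃ B, ∀ u : Set.Icc (-R) R, |g u| ≤ B := by
  obtain ⟨C, hC⟩ := (isCompact_Icc (a := -R) (b := R)).exists_bound_of_continuousOn hg.continuousOn
  exact ⟨C, fun u => hC u u.2⟩

theorem exists_iteratedDeriv_bound {g : ℝ → ℝ} (hg : ContDiff ℝ ∞ g) (R : ℝ) (p : ℕ) :
    ∃ B, ∀ u : Set.Icc (-R) R, |iteratedDeriv p g u| ≤ B :=
  exists_abs_le_of_continuous (SmoothCurve.continuous_iteratedDeriv hg p)

theorem weightedSum_dirac {R : ℝ} (p : ℕ) (u : Set.Icc (-R) R) (g : ℝ → ℝ) :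
    weightedSum p (Weights.dirac u) g = iteratedDeriv p g u :=
  Weights.tsum_dirac_mul u _

/-- Regards `g⁽ᵖ⁾`, restricted to `[-R, R]`, as an element of the dual of the Banach space `ℓ¹`,
where uniform boundedness is available. Dirac weights recover its values. -/
theorem exists_clm_weightedSum {g : ℝ → ℝ} (hg : ContDiff ℝ ∞ g) (R : ℝ) (p : ℕ) :
    ∃ T : Weights R →L[ℝ] ℝ, ∀ w, T w = weightedSum p w g := by
  obtain ⟨B, hB⟩ := exists_iteratedDeriv_bound hg R p
  exact ⟨Weights.pairing _ B hB, fun w => rfl⟩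

section

variable {E : Type*} [NormedAddCommGroup E] [NormedSpace ℝ E]

theorem deriv_snd_eq_fderiv {H : E → ℝ → ℝ} (hH : ContDiff ℝ ∞ fun q : E × ℝ => H q.1 q.2)
    (x : E) (u : ℝ) : deriv (H x) u = fderiv ℝ (fun q : E × ℝ => H q.1 q.2) (x, u) (0, 1) := by
  have h1 := ((hH.differentiable (by simp)) (x, u)).hasFDerivAt.comp_hasDerivAt u
    ((hasDerivAt_const u x).prodMk (hasDerivAt_id u))
  exact h1.deriv

theorem ContDiff.iteratedDeriv_snd {H : E → ℝ → ℝ} (hH : ContDiff ℝ ∞ fun q : E × ℝ => H q.1 q.2)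
    (p : ℕ) : ContDiff ℝ ∞ fun q : E × ℝ => iteratedDeriv p (H q.1) q.2 := by
  induction p generalizing H with
  | zero => simpa using hH
  | succ p ih =>
    simp only [iteratedDeriv_succ']
    refine ih (H := fun x => deriv (H x)) ?_
    simp only [deriv_snd_eq_fderiv hH]
    exact (hH.fderiv_right (m := ∞) (by simp)).clm_apply contDiff_const

end

theorem ContDiff.deriv_fst {g : ℝ → ℝ → ℝ} (hg : ContDiff ℝ ∞ fun q : ℝ × ℝ => g q.1 q.2) :
    ContDiff ℝ ∞ fun q : ℝ × ℝ => deriv (fun t => g t q.2) q.1 := by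
  have hswap : ContDiff ℝ ∞ fun q : ℝ × ℝ => (q.2, q.1) := contDiff_snd.prodMk contDiff_fst
  have h2 := ContDiff.iteratedDeriv_snd (H := fun u t => g t u) (hg.comp hswap) 1
  simp only [iteratedDeriv_one] at h2
  exact h2.comp hswap

/-- Termwise differentiation: near `t` the terms are dominated by `|wᵤ|` times the maximum of the
partial derivative on a compact set. -/
theorem hasDerivAt_tsum_weights {R : ℝ} (w : Weights R) {g : ℝ → ℝ → ℝ}
    (hg : ContDiff ℝ ∞ fun q : ℝ × ℝ => g q.1 q.2) (t : ℝ) :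
    HasDerivAt (fun t => ∑' u, w u * g t u) (∑' u, w u * deriv (fun t => g t u) t) t := by
  obtain ⟨C, hC⟩ := ((isCompact_closedBall t 1).prod
    (isCompact_Icc (a := -R) (b := R))).exists_bound_of_continuousOn
      hg.deriv_fst.continuous.continuousOn
  obtain ⟨B, hB⟩ := exists_abs_le_of_continuous (R := R) (g := g t)
    (hg.continuous.comp (by fun_prop : Continuous fun u : ℝ => (t, u)))
  have hs0 : Summable fun u : Set.Icc (-R) R => w u * g t u := w.summable_mul hB
  have hd : ∀ (u : Set.Icc (-R) R) (s : ℝ), HasDerivAt (fun t => w u * g t u)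
      (w u * deriv (fun t => g t u) s) s := fun u s => by
    refine HasDerivAt.const_mul (w u) (DifferentiableAt.hasDerivAt ?_)
    exact ((hg.comp (contDiff_id.prodMk contDiff_const :
      ContDiff ℝ ∞ fun t : ℝ => (t, (u : ℝ)))).differentiable (by simp)) s
  have hb : ∀ (u : Set.Icc (-R) R) (s : ℝ), s ∈ Metric.ball t 1 →
      ‖w u * deriv (fun t => g t u) s‖ ≤ |w u| * C := fun u s hs => by
    rw [norm_mul]
    exact mul_le_mul_of_nonneg_left (hC (s, u) ⟨Metric.ball_subset_closedBall hs, u.2⟩)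
      (norm_nonneg _)
  exact hasDerivAt_tsum_of_isPreconnected (w.summable_abs.mul_right C) Metric.isOpen_ball
    (convex_ball t 1).isPreconnected (fun u s _ => hd u s) hb (Metric.mem_ball_self one_pos) hs0
    (Metric.mem_ball_self one_pos)

theorem contDiff_tsum_weights {R : ℝ} (w : Weights R) {g : ℝ → ℝ → ℝ}
    (hg : ContDiff ℝ ∞ fun q : ℝ × ℝ => g q.1 q.2) : ContDiff ℝ ∞ fun t => ∑' u, w u * g t u := by
  refine contDiff_infty.2 fun N => ?_
  induction N generalizing g with
  | zero =>
    exact contDiff_zero.2 (continuous_iff_continuousAt.2 fun t =>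
      (hasDerivAt_tsum_weights w hg t).continuousAt)
  | succ N ih =>
    rw [Nat.cast_succ, contDiff_succ_iff_deriv]
    refine ⟨fun t => (hasDerivAt_tsum_weights w hg t).differentiableAt, by simp, ?_⟩
    rw [funext fun t => (hasDerivAt_tsum_weights w hg t).deriv]
    exact ih (g := fun t u => deriv (fun t => g t u) t) hg.deriv_fst

/-- Boman's theorem reduces the parameter space to a line. -/
theorem contDiff_weightedSum {E : Type*} [NormedAddCommGroup E] [NormedSpace ℝ E]
    [FiniteDimensional ℝ E] {R : ℝ} (p : ℕ) (w : Weights R) {H : E → ℝ → ℝ}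
    (hH : ContDiff ℝ ∞ fun q : E × ℝ => H q.1 q.2) :
    ContDiff ℝ ∞ fun x => weightedSum p w (H x) :=
  contDiff_of_smooth_along_curves fun c hc => contDiff_tsum_weights w
    (g := fun t u => iteratedDeriv p (H (c t)) u)
    ((ContDiff.iteratedDeriv_snd hH p).comp ((hc.comp contDiff_fst).prodMk contDiff_snd))

/-! ### Weakly smooth mappings into dual spaces -/

section Weak

variable {V : Type*} [NormedAddCommGroup V] [NormedSpace ℝ V]
variable {G : Type*} [NormedAddCommGroup G] [NormedSpace ℝ G] [CompleteSpace G]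

theorem dirDeriv_eq_fderiv {f : V → ℝ} (hf : ContDiff ℝ ∞ f) (e x : V) :
    dirDeriv e f x = fderiv ℝ f x e := by
  have h := ((hf.differentiable (by simp)) (x + (0 : ℝ) • e)).hasFDerivAt.comp_hasDerivAt (0 : ℝ)
    (((hasDerivAt_id (0 : ℝ)).smul_const e).const_add x)
  simpa [dirDeriv, Function.comp_def] using h.deriv

theorem ContDiff.dirDeriv {f : V → ℝ} (hf : ContDiff ℝ ∞ f) (e : V) :
    ContDiff ℝ ∞ (dirDeriv e f) := by
  rw [funext fun x => dirDeriv_eq_fderiv hf e x]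
  exact (hf.fderiv_right (m := ∞) (by simp)).clm_apply contDiff_const

/-- The weak derivative of a weakly smooth mapping into a dual space. -/
theorem exists_clm_dirDeriv {φ : V → G →L[ℝ] ℝ} (hφ : ∀ w, ContDiff ℝ ∞ fun v => φ v w) (e : V) :
    ∃ φ' : V → G →L[ℝ] ℝ, ∀ v w, φ' v w = dirDeriv e (fun v => φ v w) v := by
  have h : ∀ v, ∃ T : G →L[ℝ] ℝ, ∀ w, T w = dirDeriv e (fun v => φ v w) v := fun v => by
    -- A pointwise limit of continuous functionals on a Banach space is continuous; here the
    -- difference quotients converge pointwise.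
    have ht : Tendsto (fun (t : ℝ) (w : G) => (t⁻¹ • (φ (v + t • e) - φ v)) w) (𝓝[≠] 0)
        (𝓝 fun w => dirDeriv e (fun v => φ v w) v) := by
      refine tendsto_pi_nhds.2 fun w => ?_
      have hd : HasDerivAt (fun t : ℝ => φ (v + t • e) w) (dirDeriv e (fun v => φ v w) v) 0 :=
        (((hφ w).along v e).differentiable (by simp)).differentiableAt.hasDerivAt
      simpa using hasDerivAt_iff_tendsto_slope_zero.1 hd
    exact ⟨continuousLinearMapOfTendsto _ ht, fun w => rfl⟩
  choose φ' hφ' using h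
  exact ⟨φ', hφ'⟩

/-- The weak derivative is weakly smooth again, so `exists_clm_dirDeriv` can be iterated. -/
theorem exists_clm_iteratedDeriv (e : V) (p : ℕ) : ∀ {φ : V → G →L[ℝ] ℝ},
    (∀ w, ContDiff ℝ ∞ fun v => φ v w) → ∃ T : V → G →L[ℝ] ℝ,
      (∀ w, ContDiff ℝ ∞ fun v => T v w) ∧
      ∀ v w, T v w = iteratedDeriv p (fun t : ℝ => φ (v + t • e) w) 0 := by
  induction p with
  | zero => exact fun {φ} hφ => ⟨φ, hφ, fun v w => by simp⟩
  | succ p ih =>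
    intro φ hφ
    obtain ⟨φ', hφ'⟩ := exists_clm_dirDeriv hφ e
    obtain ⟨T, hT, hT'⟩ := ih (φ := φ') fun w => by
      simp only [hφ']
      exact (hφ w).dirDeriv e
    refine ⟨T, hT, fun v w => ?_⟩
    rw [hT', iteratedDeriv_succ']
    congr 1
    ext t
    rw [hφ', dirDeriv_line]

/-- The uniform boundedness principle for weakly continuous mappings. -/
theorem exists_norm_le_of_weakly_continuous [FiniteDimensional ℝ V] {φ : V → G →L[ℝ] ℝ}
    (hφ : ∀ w, Continuous fun v => φ v w) (R : ℝ) : ∃ C, ∀ v, ‖v‖ ≤ R → ‖φ v‖ ≤ C := by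
  have := FiniteDimensional.proper ℝ V
  obtain ⟨C, hC⟩ := banach_steinhaus (g := fun v : Metric.closedBall (0 : V) R => φ v) fun w => by
    obtain ⟨C, hC⟩ := (isCompact_closedBall (0 : V) R).exists_bound_of_continuousOn
      (hφ w).continuousOn
    exact ⟨C, fun v => hC v v.2⟩
  exact ⟨C, fun v hv => hC ⟨v, by simpa using hv⟩⟩

/-- A family of smooth functions of one variable that depends weakly smoothly on a parameter is
jointly smooth. -/
theorem contDiff_uncurry_of_weightedSum [FiniteDimensional ℝ V] {h : V → ℝ → ℝ}
    (h1 : ∀ v, ContDiff ℝ ∞ (h v))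
    (h2 : ∀ (R : ℝ) (p : ℕ) (w : Weights R), ContDiff ℝ ∞ fun v => weightedSum p w (h v)) :
    ContDiff ℝ ∞ fun q : V × ℝ => h q.1 q.2 := by
  choose T hT using fun v => exists_clm_weightedSum (h1 v)
  have hTs : ∀ R p w, ContDiff ℝ ∞ fun v => T v R p w := fun R p w => by
    simp only [hT]
    exact h2 R p w
  refine contDiff_of_tameAlong_basis ((Module.finBasis ℝ V).prod (Module.Basis.singleton Unit ℝ)) ?_
  rintro (i | i)
  · set e := Module.finBasis ℝ V i
    rw [Module.Basis.prod_apply]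
    simp only [Sum.elim_inl, Function.comp_apply, LinearMap.coe_inl]
    refine ⟨fun ⟨v, u⟩ => ?_, fun p R => ?_⟩
    · have hu : u ∈ Set.Icc (-|u|) |u| := ⟨neg_abs_le u, le_abs_self u⟩
      have h3 := h2 |u| 0 (Weights.dirac ⟨u, hu⟩)
      simp only [weightedSum_dirac, iteratedDeriv_zero] at h3
      simpa using h3.along v e
    -- The `p`-th derivative in the parameter is the value of the weak derivative `S v` at a Dirac
    -- weight of norm `1`, so it is bounded by `‖S v‖`.
    · obtain ⟨S, hS, hS'⟩ := exists_clm_iteratedDeriv e p (hTs R 0)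
      obtain ⟨C, hC⟩ := exists_norm_le_of_weakly_continuous (fun w => (hS w).continuous) R
      refine ⟨C, fun ⟨v, u⟩ hvu => ?_⟩
      rw [Prod.norm_mk, max_le_iff] at hvu
      have hu : u ∈ Set.Icc (-R) R := abs_le.1 hvu.2
      have h3 := (S v).le_of_opNorm_le (hC v hvu.1) (Weights.dirac ⟨u, hu⟩)
      rw [hS', Weights.norm_dirac, mul_one] at h3
      simp only [hT, weightedSum_dirac, iteratedDeriv_zero] at h3
      simpa using h3
  · rw [Module.Basis.prod_apply]
    simp only [Sum.elim_inr, Function.comp_apply, LinearMap.coe_inr, Module.Basis.singleton_apply]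
    have h3 : ∀ (v : V) (u : ℝ), (fun t : ℝ => (fun q : V × ℝ => h q.1 q.2) ((v, u) + t • (0, 1))) =
        fun t => h v (u + t) := fun v u => by
      ext t
      simp
    refine ⟨fun ⟨v, u⟩ => ?_, fun p R => ?_⟩
    · rw [h3]
      exact (h1 v).comp (contDiff_const.add contDiff_id)
    -- In the direction of `u` no weak derivative is needed: the order `p` is already built into `T
    -- v R p`.
    · obtain ⟨C, hC⟩ := exists_norm_le_of_weakly_continuous (fun w => (hTs R p w).continuous) R
      refine ⟨C, fun ⟨v, u⟩ hvu => ?_⟩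
      rw [Prod.norm_mk, max_le_iff] at hvu
      have hu : u ∈ Set.Icc (-R) R := abs_le.1 hvu.2
      have h4 := (T v R p).le_of_opNorm_le (hC v hvu.1) (Weights.dirac ⟨u, hu⟩)
      rw [hT, Weights.norm_dirac, mul_one, weightedSum_dirac] at h4
      rw [h3, iteratedDeriv_comp_const_add]
      simpa using h4

end Weak

end LocallyBounded

/-! ### Taylor expansion with parameters -/

theorem ContDiff.fst_slice {F G : Type*} [NormedAddCommGroup F] [NormedSpace ℝ F]
    [NormedAddCommGroup G] [NormedSpace ℝ G] {H : F → G → ℝ}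
    (hH : ContDiff ℝ ∞ fun q : F × G => H q.1 q.2) (x : G) : ContDiff ℝ ∞ fun v => H v x :=
  hH.comp (contDiff_id.prodMk contDiff_const)

theorem ContDiff.snd_slice {F G : Type*} [NormedAddCommGroup F] [NormedSpace ℝ F]
    [NormedAddCommGroup G] [NormedSpace ℝ G] {H : F → G → ℝ}
    (hH : ContDiff ℝ ∞ fun q : F × G => H q.1 q.2) (v : F) : ContDiff ℝ ∞ (H v) :=
  hH.comp (contDiff_const.prodMk contDiff_id)

section Hadamard

variable {n : ℕ} {E : Type} [NormedAddCommGroup E] [NormedSpace ℝ E]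

/-- Hadamard's lemma with parameters. -/
theorem exists_eq_add_sum_coord_mul [FiniteDimensional ℝ E] {H : (Fin n → ℝ) → E → ℝ}
    (hH : ContDiff ℝ ∞ fun q : (Fin n → ℝ) × E => H q.1 q.2) :
    ∃ G : Fin n → (Fin n → ℝ) → E → ℝ,
      (∀ i, ContDiff ℝ ∞ fun q : (Fin n → ℝ) × E => G i q.1 q.2) ∧
      ∀ v x, H v x = H 0 x + ∑ i, v i * G i v x := by
  set F : (Fin n → ℝ) × E → ℝ := fun q => H q.1 q.2 with hF
  let D : Fin n → ((Fin n → ℝ) × E) × ℝ → ℝ := fun i p =>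
    fderiv ℝ F (p.2 • p.1.1, p.1.2) (Pi.single i 1, 0)
  have hD : ∀ i, ContDiff ℝ ∞ (D i) := fun i =>
    ((hH.fderiv_right (m := ∞) (by simp)).comp
      ((contDiff_snd.smul contDiff_fst.fst).prodMk contDiff_fst.snd)).clm_apply contDiff_const
  refine ⟨fun i v x => ∫ t in (0 : ℝ)..1, D i ((v, x), t),
    fun i => contDiff_infty.2 fun N => SmoothFun.contDiff_integral N (D i) (hD i), fun v x => ?_⟩
  have hd : ∀ t : ℝ, HasDerivAt (fun t : ℝ => F (t • v, x)) (fderiv ℝ F (t • v, x) (v, 0)) t := by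
    intro t
    have h1 : HasFDerivAt F (fderiv ℝ F (t • v, x)) (t • v, x) :=
      (hH.differentiable (by simp)).differentiableAt.hasFDerivAt
    have h2 : HasDerivAt (fun t : ℝ => (t • v, x)) (v, 0) t := by
      simpa using ((hasDerivAt_id t).smul_const v).prodMk (hasDerivAt_const t x)
    exact h1.comp_hasDerivAt t h2
  have hc : ∀ w : (Fin n → ℝ) × E, Continuous fun t : ℝ => fderiv ℝ F (t • v, x) w := fun w =>
    ((hH.continuous_fderiv (by simp)).comp (by fun_prop)).clm_apply continuous_const
  have h3 := intervalIntegral.integral_eq_sub_of_hasDerivAt (a := (0 : ℝ)) (b := 1)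
    (fun t _ => hd t) ((hc _).intervalIntegrable _ _)
  simp only [one_smul, zero_smul] at h3
  have h4 : ∀ t : ℝ, fderiv ℝ F (t • v, x) (v, 0) = ∑ i, v i * D i ((v, x), t) := by
    intro t
    have hv : ((v, 0) : (Fin n → ℝ) × E) = ∑ i, v i • ((Pi.single i (1 : ℝ) : Fin n → ℝ), (0 : E)) := by
      ext j
      · simp [Prod.fst_sum, Finset.sum_apply, Pi.single_apply]
      · simp [Prod.snd_sum]
    conv_lhs => rw [hv]
    rw [map_sum]
    exact Finset.sum_congr rfl fun i _ => by rw [map_smul, smul_eq_mul]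
  have h5 : (∫ t in (0 : ℝ)..1, fderiv ℝ F (t • v, x) (v, 0)) =
      ∑ i, v i * ∫ t in (0 : ℝ)..1, D i ((v, x), t) := by
    simp_rw [h4]
    rw [intervalIntegral.integral_finsetSum (f := fun i t => v i * D i ((v, x), t))
      fun i _ => (continuous_const.mul (hc _)).intervalIntegrable _ _]
    simp only [intervalIntegral.integral_const_mul]
  rw [← h5, h3]
  simp [hF]

/-- A smooth function of `v ∈ ℝⁿ` and of a parameter has an expansion modulo an ideal `K` of
`C^∞(ℝⁿ)` if it is, up to a combination of elements of `K`, a sum of products of functions of `v`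
and functions of the parameter. -/
def HasExpansion (K : Ideal (SmoothFun n)) (H : (Fin n → ℝ) → E → ℝ) : Prop :=
  ∃ (ι κ : Type) (_ : Fintype ι) (_ : Fintype κ) (p : ι → SmoothFun n) (h : ι → E → ℝ)
    (m : κ → SmoothFun n) (G : κ → (Fin n → ℝ) → E → ℝ),
    (∀ i, ContDiff ℝ ∞ (h i)) ∧ (∀ k, m k ∈ K) ∧
    (∀ k, ContDiff ℝ ∞ fun q : (Fin n → ℝ) × E => G k q.1 q.2) ∧
    ∀ v x, H v x = ∑ i, (p i).toFun v * h i x + ∑ k, (m k).toFun v * G k v x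

namespace HasExpansion

variable {K K' : Ideal (SmoothFun n)} {H H' : (Fin n → ℝ) → E → ℝ}

theorem add (h₁ : HasExpansion K H) (h₂ : HasExpansion K H') :
    HasExpansion K fun v x => H v x + H' v x := by
  obtain ⟨ι, κ, _, _, p, h, m, G, hh, hm, hG, he⟩ := h₁
  obtain ⟨ι', κ', _, _, p', h', m', G', hh', hm', hG', he'⟩ := h₂
  refine ⟨ι ⊕ ι', κ ⊕ κ', inferInstance, inferInstance, Sum.elim p p', Sum.elim h h',
    Sum.elim m m', Sum.elim G G', ?_, ?_, ?_, fun v x => ?_⟩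
  · rintro (i | i)
    exacts [hh i, hh' i]
  · rintro (i | i)
    exacts [hm i, hm' i]
  · rintro (i | i)
    exacts [hG i, hG' i]
  · simp only [he, he', Fintype.sum_sum_type, Sum.elim_inl, Sum.elim_inr]
    ring

theorem of_param {h : E → ℝ} (hh : ContDiff ℝ ∞ h) :
    HasExpansion K fun (_ : Fin n → ℝ) x => h x :=
  ⟨Unit, Empty, inferInstance, inferInstance, fun _ => 1, fun _ => h, Empty.elim, Empty.elim,
    fun _ => hh, fun k => k.elim, fun k => k.elim, fun v x => by
      have : (1 : SmoothFun n).toFun v = 1 := rfl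
      simp [this]⟩

theorem sum {α : Type} (s : Finset α) {H : α → (Fin n → ℝ) → E → ℝ}
    (h : ∀ a, HasExpansion K (H a)) : HasExpansion K fun v x => ∑ a ∈ s, H a v x := by
  classical
  induction s using Finset.induction_on with
  | empty => simpa using of_param (K := K) (h := fun _ : E => (0 : ℝ)) contDiff_const
  | insert a s ha ih =>
    simp only [Finset.sum_insert ha]
    exact (h a).add ih

theorem mul (h : HasExpansion K H) (q : SmoothFun n) (hq : ∀ x ∈ K, q * x ∈ K') :
    HasExpansion K' fun v x => q.toFun v * H v x := by
  obtain ⟨ι, κ, _, _, p, h, m, G, hh, hm, hG, he⟩ := h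
  refine ⟨ι, κ, inferInstance, inferInstance, fun i => q * p i, h, fun k => q * m k, G, hh,
    fun k => hq _ (hm k), hG, fun v x => ?_⟩
  have hmul : ∀ a : SmoothFun n, (q * a).toFun v = q.toFun v * a.toFun v := fun a => rfl
  simp only [he, hmul, mul_add, Finset.mul_sum, mul_assoc]

theorem mono (h : HasExpansion K H) (hK : K ≤ K') : HasExpansion K' H := by
  obtain ⟨ι, κ, _, _, p, h, m, G, hh, hm, hG, he⟩ := h
  exact ⟨ι, κ, inferInstance, inferInstance, p, h, m, G, hh, fun k => hK (hm k), hG, he⟩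

end HasExpansion

/-- Taylor expansion by repeated use of Hadamard's lemma: each round splits off the value at `v = 0`
and multiplies the remainder by a coordinate, raising the power of the maximal ideal by one. -/
theorem hasExpansion_pow [FiniteDimensional ℝ E] (N : ℕ) {H : (Fin n → ℝ) → E → ℝ}
    (hH : ContDiff ℝ ∞ fun q : (Fin n → ℝ) × E => H q.1 q.2) :
    HasExpansion (SmoothFun.maxIdeal n ^ N) H := by
  induction N generalizing H with
  | zero =>
    refine ⟨Empty, Unit, inferInstance, inferInstance, Empty.elim, Empty.elim, fun _ => 1,
      fun _ => H, fun i => i.elim, fun _ => by simp, fun _ => hH, fun v x => ?_⟩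
    have : (1 : SmoothFun n).toFun v = 1 := rfl
    simp [this]
  | succ N ih =>
    obtain ⟨G, hG, he⟩ := exists_eq_add_sum_coord_mul hH
    have h0 : ContDiff ℝ ∞ (H 0) := hH.comp (contDiff_const.prodMk contDiff_id)
    rw [show H = fun v x => H 0 x + ∑ i, v i * G i v x from funext fun v => funext fun x => he v x]
    refine (HasExpansion.of_param h0).add (HasExpansion.sum _ fun i => ?_)
    refine (ih (hG i)).mul (SmoothFun.coord i) fun x hx => ?_
    rw [pow_succ']
    exact Ideal.mul_mem_mul (SmoothFun.mem_maxIdeal.2 rfl) hx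

end Hadamard

/-! ### Jets -/

namespace WeilAlgebra

variable (W : WeilAlgebra)

/-- The underlying algebra of a Weil algebra. -/
abbrev Carrier : Type := SmoothFun W.dim ⧸ W.ideal

/-- The class in a Weil algebra of a smooth function (and zero for other functions). -/
def jet (f : (Fin W.dim → ℝ) → ℝ) : W.Carrier := by
  classical
  exact if h : ContDiff ℝ ∞ f then Ideal.Quotient.mk W.ideal (SmoothFun.mk f h) else 0

variable {W}

theorem jet_eq {f : (Fin W.dim → ℝ) → ℝ} (h : ContDiff ℝ ∞ f) :
    W.jet f = Ideal.Quotient.mk W.ideal (SmoothFun.mk f h) := dif_pos h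

theorem jet_toFun (f : SmoothFun W.dim) : W.jet f.toFun = Ideal.Quotient.mk W.ideal f :=
  jet_eq f.contDiff

theorem jet_add {f g : (Fin W.dim → ℝ) → ℝ} (hf : ContDiff ℝ ∞ f) (hg : ContDiff ℝ ∞ g) :
    W.jet (fun v => f v + g v) = W.jet f + W.jet g := by
  rw [jet_eq hf, jet_eq hg, jet_eq (hf.add hg), ← map_add]
  rfl

theorem jet_mul {f g : (Fin W.dim → ℝ) → ℝ} (hf : ContDiff ℝ ∞ f) (hg : ContDiff ℝ ∞ g) :
    W.jet (fun v => f v * g v) = W.jet f * W.jet g := by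
  rw [jet_eq hf, jet_eq hg, jet_eq (hf.mul hg), ← map_mul]
  rfl

theorem jet_const_mul (r : ℝ) {f : (Fin W.dim → ℝ) → ℝ} (hf : ContDiff ℝ ∞ f) :
    W.jet (fun v => r * f v) = r • W.jet f := by
  rw [jet_eq hf, jet_eq (contDiff_const.mul hf)]
  rfl

theorem jet_zero : W.jet (fun _ => 0) = 0 := by
  rw [jet_eq contDiff_const]
  exact map_zero _

theorem jet_sum {α : Type*} (s : Finset α) {f : α → (Fin W.dim → ℝ) → ℝ}
    (hf : ∀ a, ContDiff ℝ ∞ (f a)) : W.jet (fun v => ∑ a ∈ s, f a v) = ∑ a ∈ s, W.jet (f a) := by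
  classical
  induction s using Finset.induction_on with
  | empty => simpa using jet_zero
  | insert a s ha ih =>
    simp only [Finset.sum_insert ha]
    rw [jet_add (hf a) (ContDiff.sum fun a _ => hf a), ih]

theorem jet_eq_zero_of_mem {m : SmoothFun W.dim} (hm : m ∈ W.ideal)
    {f : (Fin W.dim → ℝ) → ℝ} (hf : ContDiff ℝ ∞ f) : W.jet (fun v => m.toFun v * f v) = 0 := by
  rw [jet_mul m.contDiff hf, jet_toFun, Ideal.Quotient.eq_zero_iff_mem.2 hm, zero_mul]

section Expansion

variable {E : Type} [NormedAddCommGroup E] [NormedSpace ℝ E]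

/-- The ideal of a Weil algebra contains a power of the maximal ideal. -/
theorem hasExpansion [FiniteDimensional ℝ E] {H : (Fin W.dim → ℝ) → E → ℝ}
    (hH : ContDiff ℝ ∞ fun q : (Fin W.dim → ℝ) × E => H q.1 q.2) : HasExpansion W.ideal H :=
  let ⟨N, hN⟩ := W.exists_pow_le
  (hasExpansion_pow N hH).mono hN

/-- The coefficients may depend on `v`, so that this covers both a fixed parameter and a parameter
set equal to `v`. -/
theorem jet_expansion {ι κ : Type} [Fintype ι] [Fintype κ] {p : ι → SmoothFun W.dim}
    {h : ι → (Fin W.dim → ℝ) → ℝ} {m : κ → SmoothFun W.dim} {G : κ → (Fin W.dim → ℝ) → ℝ}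
    (hh : ∀ i, ContDiff ℝ ∞ (h i)) (hm : ∀ k, m k ∈ W.ideal) (hG : ∀ k, ContDiff ℝ ∞ (G k)) :
    W.jet (fun v => ∑ i, (p i).toFun v * h i v + ∑ k, (m k).toFun v * G k v) =
      ∑ i, W.jet (p i).toFun * W.jet (h i) := by
  rw [jet_add (ContDiff.sum fun i _ => (p i).contDiff.mul (hh i))
      (ContDiff.sum fun k _ => (m k).contDiff.mul (hG k)),
    jet_sum _ fun i => (p i).contDiff.mul (hh i), jet_sum _ fun k => (m k).contDiff.mul (hG k)]
  simp only [jet_eq_zero_of_mem (hm _) (hG _), Finset.sum_const_zero, add_zero,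
    jet_mul (p _).contDiff (hh _)]

theorem jet_const_eq (r : ℝ) : W.jet (fun _ => r) = algebraMap ℝ W.Carrier r := by
  rw [jet_eq contDiff_const]
  rfl

/-- The parameter enters only through finitely many scalar coefficients of fixed jets. -/
theorem jet_param_expansion {H : (Fin W.dim → ℝ) → E → ℝ} {ι κ : Type} [Fintype ι] [Fintype κ]
    {p : ι → SmoothFun W.dim}
    {h : ι → E → ℝ} {m : κ → SmoothFun W.dim} {G : κ → (Fin W.dim → ℝ) → E → ℝ}
    (hm : ∀ k, m k ∈ W.ideal)
    (hG : ∀ k, ContDiff ℝ ∞ fun q : (Fin W.dim → ℝ) × E => G k q.1 q.2)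
    (he : ∀ v x, H v x = ∑ i, (p i).toFun v * h i x + ∑ k, (m k).toFun v * G k v x) (x : E) :
    W.jet (fun v => H v x) = ∑ i, h i x • W.jet (p i).toFun := by
  simp only [he]
  rw [jet_expansion (h := fun i _ => h i x) (G := fun k v => G k v x) (fun _ => contDiff_const) hm
    fun k => ContDiff.fst_slice (hG k) x]
  refine Finset.sum_congr rfl fun i _ => ?_
  rw [jet_const_eq, mul_comm, Algebra.smul_def]

/-- The jet of a smooth function depends smoothly on parameters. -/
theorem contDiff_jet_param [FiniteDimensional ℝ E] {H : (Fin W.dim → ℝ) → E → ℝ}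
    (hH : ContDiff ℝ ∞ fun q : (Fin W.dim → ℝ) × E => H q.1 q.2) (l : W.Carrier →ₗ[ℝ] ℝ) :
    ContDiff ℝ ∞ fun x => l (W.jet fun v => H v x) := by
  obtain ⟨ι, κ, _, _, p, h, m, G, hh, hm, hG, he⟩ := hasExpansion hH
  simp only [jet_param_expansion hm hG he, map_sum, map_smul, smul_eq_mul]
  exact ContDiff.sum fun i _ => (hh i).mul contDiff_const

end Expansion

/-- The jet of the restriction of a function to the diagonal is determined by iterated jets. -/
theorem jet_diag {ι : Type*} [Fintype ι] (b : Module.Basis ι ℝ W.Carrier)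
    {H : (Fin W.dim → ℝ) → (Fin W.dim → ℝ) → ℝ}
    (hH : ContDiff ℝ ∞ fun q : (Fin W.dim → ℝ) × (Fin W.dim → ℝ) => H q.1 q.2) :
    W.jet (fun v => H v v) = ∑ i, ∑ j,
      b.coord j (W.jet fun x => b.coord i (W.jet fun v => H v x)) • (b i * b j) := by
  obtain ⟨ι', κ, _, _, p, h, m, G, hh, hm, hG, he⟩ := hasExpansion hH
  have h1 : ∀ i j, b.coord j (W.jet fun x => b.coord i (W.jet fun v => H v x)) =
      ∑ k, b.coord i (W.jet (p k).toFun) * b.coord j (W.jet (h k)) := fun i j => by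
    simp only [jet_param_expansion hm hG he, map_sum, map_smul, smul_eq_mul]
    rw [jet_sum _ fun k => (hh k).mul contDiff_const, map_sum]
    refine Finset.sum_congr rfl fun k _ => ?_
    simp only [mul_comm (h k _)]
    rw [jet_const_mul _ (hh k), map_smul, smul_eq_mul]
  simp only [h1]
  simp only [he]
  -- On the diagonal the remainder is still a combination of elements of the ideal, so only `∑ jet
  -- pₖ * jet hₖ` survives. The iterated jets give the same sum in coordinates.
  rw [jet_expansion (h := h) (G := fun k v => G k v v) hh hm fun k =>
    (hG k).comp (contDiff_id.prodMk contDiff_id)]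
  have h2 : ∀ k, W.jet (p k).toFun * W.jet (h k) = ∑ i, ∑ j,
      (b.coord i (W.jet (p k).toFun) * b.coord j (W.jet (h k))) • (b i * b j) := fun k => by
    conv_lhs => rw [← b.sum_repr (W.jet (p k).toFun), ← b.sum_repr (W.jet (h k))]
    rw [Finset.sum_mul_sum]
    simp only [smul_mul_smul_comm, Module.Basis.coord_apply]
  simp only [h2, Finset.sum_smul]
  rw [Finset.sum_comm]
  exact Finset.sum_congr rfl fun i _ => Finset.sum_comm

end WeilAlgebra

/-! ### Jets of weighted sums -/

theorem weightedSum_add {R : ℝ} (p : ℕ) (w : Weights R) {f g : ℝ → ℝ} (hf : ContDiff ℝ ∞ f)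
    (hg : ContDiff ℝ ∞ g) :
    weightedSum p w (fun u => f u + g u) = weightedSum p w f + weightedSum p w g := by
  obtain ⟨B, hB⟩ := exists_iteratedDeriv_bound hf R p
  obtain ⟨B', hB'⟩ := exists_iteratedDeriv_bound hg R p
  unfold weightedSum
  rw [← (w.summable_mul hB).tsum_add (w.summable_mul hB')]
  refine tsum_congr fun u => ?_
  have hp : ((p : ℕ∞) : WithTop ℕ∞) ≤ ∞ := by exact_mod_cast le_top
  have h : iteratedDeriv p (fun u => f u + g u) u = _ :=
    iteratedDeriv_add (hf.of_le hp).contDiffAt (hg.of_le hp).contDiffAt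
  rw [h, mul_add]

theorem weightedSum_const_mul {R : ℝ} (p : ℕ) (w : Weights R) (c : ℝ) (f : ℝ → ℝ) :
    weightedSum p w (fun u => c * f u) = c * weightedSum p w f := by
  unfold weightedSum
  rw [← tsum_mul_left]
  refine tsum_congr fun u => ?_
  rw [iteratedDeriv_const_mul_field]
  ring

theorem weightedSum_sum {R : ℝ} (p : ℕ) (w : Weights R) {α : Type*} (s : Finset α)
    {f : α → ℝ → ℝ} (hf : ∀ a, ContDiff ℝ ∞ (f a)) :
    weightedSum p w (fun u => ∑ a ∈ s, f a u) = ∑ a ∈ s, weightedSum p w (f a) := by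
  classical
  induction s using Finset.induction_on with
  | empty => simpa using weightedSum_const_mul p w 0 fun _ => 0
  | insert a s ha ih =>
    simp only [Finset.sum_insert ha]
    rw [weightedSum_add p w (hf a) (ContDiff.sum fun a _ => hf a), ih]

/-- Taking jets commutes with taking weighted sums in a parameter. -/
theorem WeilAlgebra.jet_weightedSum {W : WeilAlgebra} {R : ℝ} (p : ℕ) (w : Weights R)
    {H : (Fin W.dim → ℝ) → ℝ → ℝ}
    (hH : ContDiff ℝ ∞ fun q : (Fin W.dim → ℝ) × ℝ => H q.1 q.2) (l : W.Carrier →ₗ[ℝ] ℝ) :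
    l (W.jet fun v => weightedSum p w (H v)) =
      weightedSum p w fun u => l (W.jet fun v => H v u) := by
  obtain ⟨ι, κ, _, _, q, h, m, G, hh, hm, hG, he⟩ := hasExpansion hH
  -- The weighted sum acts on `u` alone and therefore preserves the shape of the expansion, with the
  -- same elements `m k` of the ideal.
  have h1 : ∀ v, weightedSum p w (H v) = ∑ i, (q i).toFun v * weightedSum p w (h i) +
      ∑ k, (m k).toFun v * weightedSum p w (G k v) := fun v => by
    have hGv := fun k => ContDiff.snd_slice (hG k) v
    rw [show H v = fun u => _ from funext fun u => he v u]
    rw [weightedSum_add p w (ContDiff.sum fun i _ => contDiff_const.mul (hh i))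
      (ContDiff.sum fun k _ => contDiff_const.mul (hGv k)),
      weightedSum_sum p w _ fun i => contDiff_const.mul (hh i),
      weightedSum_sum p w _ fun k => contDiff_const.mul (hGv k)]
    simp only [weightedSum_const_mul]
  simp only [h1]
  rw [jet_expansion (h := fun i _ => weightedSum p w (h i))
    (G := fun k v => weightedSum p w (G k v)) (fun _ => contDiff_const) hm
    fun k => contDiff_weightedSum p w (hG k)]
  simp only [jet_param_expansion hm hG he, map_sum, map_smul, smul_eq_mul]
  rw [weightedSum_sum p w _ fun i => (hh i).mul contDiff_const]
  refine Finset.sum_congr rfl fun i _ => ?_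
  simp only [mul_comm (h i _)]
  rw [weightedSum_const_mul, jet_const_eq, mul_comm, ← Algebra.smul_def, map_smul, smul_eq_mul,
    mul_comm]

namespace FrolicherSpace

variable {X Y Z : FrolicherSpace.{u}}

/-! ### Plots -/

theorem const_mem_curves (x : X) : (fun _ => x) ∈ X.curves :=
  (X.mem_curves_iff _).2 fun _ _ => contDiff_const

theorem contDiff_of_mem {χ : X → ℝ} (hχ : χ ∈ X.functions) {c : ℝ → X} (hc : c ∈ X.curves) :
    ContDiff ℝ ∞ fun t => χ (c t) :=
  (X.mem_curves_iff c).1 hc χ hχ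

theorem comp_mem_curves {c : ℝ → X} (hc : c ∈ X.curves) {a : ℝ → ℝ} (ha : ContDiff ℝ ∞ a) :
    (fun t => c (a t)) ∈ X.curves :=
  (X.mem_curves_iff _).2 fun _ hχ => (contDiff_of_mem hχ hc).comp ha

theorem Hom.comp_mem_functions (f : Hom X Y) {χ : Y → ℝ} (hχ : χ ∈ Y.functions) :
    (fun x => χ (f.toFun x)) ∈ X.functions :=
  (X.mem_functions_iff _).2 fun _ hc => contDiff_of_mem hχ (f.smooth _ hc)

/-- A mapping from a finite dimensional vector space to a Frölicher space that sends smooth curves to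
curves. -/
def IsPlot {E : Type*} [NormedAddCommGroup E] [NormedSpace ℝ E] (f : E → X) : Prop :=
  ∀ c : ℝ → E, ContDiff ℝ ∞ c → (fun t => f (c t)) ∈ X.curves

theorem IsPlot.contDiff {E : Type*} [NormedAddCommGroup E] [NormedSpace ℝ E]
    [FiniteDimensional ℝ E] {f : E → X} (hf : IsPlot f) {χ : X → ℝ} (hχ : χ ∈ X.functions) :
    ContDiff ℝ ∞ fun v => χ (f v) :=
  contDiff_of_smooth_along_curves fun c hc => contDiff_of_mem hχ (hf c hc)

theorem isPlot_of_mem_curves {c : ℝ → X} (hc : c ∈ X.curves) : IsPlot c :=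
  fun _ ha => comp_mem_curves hc ha

namespace SmoothFrom

variable {n m : ℕ}

theorem isPlot (f : SmoothFrom n X) : IsPlot f.toFun := fun _ hc =>
  (X.mem_curves_iff _).2 fun χ hχ => (f.smooth χ hχ).comp hc

/-- A plot, as a smooth mapping. -/
def ofIsPlot (f : (Fin n → ℝ) → X) (hf : IsPlot f) : SmoothFrom n X :=
  ⟨f, fun _ hχ => hf.contDiff hχ⟩

/-- Composition with a smooth mapping of Frölicher spaces. -/
def map (g : Hom X Y) (f : SmoothFrom n X) : SmoothFrom n Y :=
  ⟨fun v => g.toFun (f.toFun v), fun _ hχ => f.smooth _ (g.comp_mem_functions hχ)⟩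

/-- Composition with a smooth mapping of Euclidean spaces. -/
def reparam (f : SmoothFrom n X) (φ : (Fin m → ℝ) → Fin n → ℝ) (hφ : ContDiff ℝ ∞ φ) :
    SmoothFrom m X :=
  ⟨fun v => f.toFun (φ v), fun χ hχ => (f.smooth χ hχ).comp hφ⟩

/-- The constant mapping. -/
def const (n : ℕ) (x : X) : SmoothFrom n X := ⟨fun _ => x, fun _ _ => contDiff_const⟩

end SmoothFrom

/-! ### Products -/

/-- The product of two Frölicher spaces. -/
def prod (X Y : FrolicherSpace.{u}) : FrolicherSpace.{u} where
  carrier := X × Y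
  curves := {c | (fun t => (c t).1) ∈ X.curves ∧ (fun t => (c t).2) ∈ Y.curves}
  functions := {χ | ∀ c : ℝ → X × Y, (fun t => (c t).1) ∈ X.curves →
    (fun t => (c t).2) ∈ Y.curves → ContDiff ℝ ∞ fun t => χ (c t)}
  mem_curves_iff c := ⟨fun hc _ hχ => hχ c hc.1 hc.2, fun h =>
    ⟨(X.mem_curves_iff _).2 fun χ hχ => h (fun p => χ p.1) fun _ hd _ => contDiff_of_mem hχ hd,
      (Y.mem_curves_iff _).2 fun χ hχ => h (fun p => χ p.2) fun _ _ hd => contDiff_of_mem hχ hd⟩⟩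
  mem_functions_iff _ := ⟨fun h c hc => h c hc.1 hc.2, fun h c hc hc' => h c ⟨hc, hc'⟩⟩

/-- The one point Frölicher space. -/
def point : FrolicherSpace.{u} where
  carrier := PUnit
  curves := Set.univ
  functions := Set.univ
  mem_curves_iff _ := ⟨fun _ χ _ => (contDiff_const : ContDiff ℝ ∞ fun _ : ℝ => χ PUnit.unit),
    fun _ => trivial⟩
  mem_functions_iff χ := ⟨fun _ _ _ => (contDiff_const : ContDiff ℝ ∞ fun _ : ℝ => χ PUnit.unit),
    fun _ => trivial⟩

namespace Hom

/-- Composition. -/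
protected def comp (g : Hom Y Z) (f : Hom X Y) : Hom X Z :=
  ⟨fun x => g.toFun (f.toFun x), fun c hc => g.smooth _ (f.smooth c hc)⟩

/-- The first projection. -/
def fst (X Y : FrolicherSpace.{u}) : Hom (X.prod Y) X := ⟨fun p => p.1, fun _ hc => hc.1⟩

/-- The second projection. -/
def snd (X Y : FrolicherSpace.{u}) : Hom (X.prod Y) Y := ⟨fun p => p.2, fun _ hc => hc.2⟩

/-- The mapping into a product. -/
def lift (f : Hom Z X) (g : Hom Z Y) : Hom Z (X.prod Y) :=
  ⟨fun z => (f.toFun z, g.toFun z), fun c hc => ⟨f.smooth c hc, g.smooth c hc⟩⟩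

/-- The mapping onto a point. -/
def toPoint (X : FrolicherSpace.{u}) : Hom X point.{u} := ⟨fun _ => PUnit.unit, fun _ _ => trivial⟩

end Hom

/-- An isomorphism of Frölicher spaces, from mutually inverse smooth mappings. -/
def mkIso (f : Hom X Y) (g : Hom Y X) (h₁ : ∀ x, g.toFun (f.toFun x) = x)
    (h₂ : ∀ y, f.toFun (g.toFun y) = y) : X ≅ Y where
  hom := f
  inv := g
  hom_inv_id := Hom.ext (funext h₁)
  inv_hom_id := Hom.ext (funext h₂)

theorem inv_hom_apply (e : X ≅ Y) (x : X) : Hom.toFun e.inv (Hom.toFun e.hom x) = x :=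
  congrFun (congrArg Hom.toFun e.hom_inv_id) x

theorem hom_inv_apply (e : X ≅ Y) (y : Y) : Hom.toFun e.hom (Hom.toFun e.inv y) = y :=
  congrFun (congrArg Hom.toFun e.inv_hom_id) y

/-- The product of two isomorphisms. -/
def prodIso {X' Y' : FrolicherSpace.{u}} (e : X ≅ X') (e' : Y ≅ Y') : X.prod Y ≅ X'.prod Y' :=
  mkIso (Hom.lift (Hom.comp e.hom (Hom.fst X Y)) (Hom.comp e'.hom (Hom.snd X Y)))
    (Hom.lift (Hom.comp e.inv (Hom.fst X' Y')) (Hom.comp e'.inv (Hom.snd X' Y')))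
    (fun p => Prod.ext (inv_hom_apply e p.1) (inv_hom_apply e' p.2))
    (fun p => Prod.ext (hom_inv_apply e p.1) (hom_inv_apply e' p.2))

theorem IsPlot.prodMk {E : Type*} [NormedAddCommGroup E] [NormedSpace ℝ E] {f : E → X} {g : E → Y}
    (hf : IsPlot f) (hg : IsPlot g) : IsPlot (X := X.prod Y) fun v => (f v, g v) :=
  fun c hc => ⟨hf c hc, hg c hc⟩

theorem IsPlot.comp_fst {E F : Type*} [NormedAddCommGroup E] [NormedSpace ℝ E]
    [NormedAddCommGroup F] [NormedSpace ℝ F] {f : E → X} (hf : IsPlot f) :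
    IsPlot fun p : E × F => f p.1 :=
  fun _ hc => hf _ (contDiff_fst.comp hc)

theorem IsPlot.comp_snd {E F : Type*} [NormedAddCommGroup E] [NormedSpace ℝ E]
    [NormedAddCommGroup F] [NormedSpace ℝ F] {f : F → X} (hf : IsPlot f) :
    IsPlot fun p : E × F => f p.2 :=
  fun _ hc => hf _ (contDiff_snd.comp hc)

/-! ### Exponentials -/

/-- The curves of `X^Y` are exactly the curves that generate its structure. -/
theorem mem_curves_exponential {c : ℝ → X.exponential Y} :
    c ∈ (X.exponential Y).curves ↔ ∀ a : ℝ → ℝ, ContDiff ℝ ∞ a → ∀ y ∈ Y.curves,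
      (fun t => Hom.toFun (c (a t)) (y t)) ∈ X.curves := by
  refine ⟨fun hc a ha y hy => (X.mem_curves_iff _).2 fun χ hχ => ?_,
    fun hc _ hθ => hθ c hc⟩
  have hs : ∀ g : Hom Y X, ContDiff ℝ ∞ fun u => χ (g.toFun (y u)) := fun g =>
    contDiff_of_mem hχ (g.smooth y hy)
  have hj : ContDiff ℝ ∞ fun q : ℝ × ℝ => χ (Hom.toFun (c q.1) (y q.2)) := by
    refine contDiff_uncurry_of_weightedSum (h := fun t u => χ (Hom.toFun (c t) (y u)))
      (fun t => hs (c t)) fun R p w => ?_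
    -- The weighted sums are functions on `X^Y` because they are smooth along the generating curves
    -- `d`, for which joint smoothness holds by Boman's theorem. Hence they may be tested on `c`.
    refine hc (fun g : Hom Y X => weightedSum p w fun u => χ (g.toFun (y u))) fun d hd => ?_
    refine contDiff_weightedSum p w (H := fun t u => χ ((d t).toFun (y u))) ?_
    exact contDiff_of_smooth_along_curves fun b hb => contDiff_of_mem hχ
      (hd _ (contDiff_fst.comp hb) _ (comp_mem_curves hy (contDiff_snd.comp hb)))
  exact hj.comp (ha.prodMk contDiff_id)

/-- The evaluation mapping. -/
def Hom.eval (X Y : FrolicherSpace.{u}) : Hom ((X.exponential Y).prod Y) X :=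
  ⟨fun p => Hom.toFun p.1 p.2, fun _ hc =>
    mem_curves_exponential.1 hc.1 (fun t => t) contDiff_id _ hc.2⟩

/-- The exponential adjunct of a mapping on a product. -/
def Hom.curry (f : Hom (Y.prod Z) X) : Hom Z (X.exponential Y) where
  toFun z := ⟨fun y => f.toFun (y, z), fun c hc => f.smooth (fun t => (c t, z))
    ⟨hc, const_mem_curves z⟩⟩
  smooth c hc := mem_curves_exponential.2 fun _ ha y hy =>
    f.smooth (fun t => (y t, c _)) ⟨hy, comp_mem_curves hc ha⟩

/-- The inverse of currying. -/
def Hom.uncurry (f : Hom Z (X.exponential Y)) : Hom (Y.prod Z) X :=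
  (Hom.eval X Y).comp (Hom.lift (f.comp (Hom.snd Y Z)) (Hom.fst Y Z))

/-- The functor `X ↦ X^Y`. -/
def exponentialFunctor (Y : FrolicherSpace.{u}) : FrolicherSpace.{u} ⥤ FrolicherSpace.{u} where
  obj X := X.exponential Y
  map {X X'} f :=
    { toFun := fun g : Hom Y X => (Hom.comp f g : Hom Y X')
      smooth := fun _ hc => mem_curves_exponential.2 fun a ha y hy =>
        Hom.smooth f _ (mem_curves_exponential.1 hc a ha y hy) }

/-- The isomorphism `(X^Z)^Y ≅ X^(Z × Y)`. -/
def exponentialProdIso (X Y Z : FrolicherSpace.{u}) :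
    (X.exponential Z).exponential Y ≅ X.exponential (Z.prod Y) :=
  mkIso
    { toFun := fun f => Hom.uncurry f
      smooth := fun _ hc => mem_curves_exponential.2 fun a ha _ hp =>
        mem_curves_exponential.1 (mem_curves_exponential.1 hc a ha _ hp.2) (fun t => t) contDiff_id
          _ hp.1 }
    { toFun := fun f => Hom.curry f
      smooth := fun _ hc => mem_curves_exponential.2 fun a ha _ hy =>
        mem_curves_exponential.2 fun b hb _ hz =>
          mem_curves_exponential.1 hc (fun t => a (b t)) (ha.comp hb) (fun _ => (_, _))
            ⟨hz, comp_mem_curves hy hb⟩ }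
    (fun _ => rfl) (fun _ => rfl)

/-- The isomorphism `(X × Y)^Z ≅ X^Z × Y^Z`. -/
def prodExponentialIso (X Y Z : FrolicherSpace.{u}) :
    (X.prod Y).exponential Z ≅ (X.exponential Z).prod (Y.exponential Z) :=
  mkIso (Hom.lift ((exponentialFunctor Z).map (Hom.fst X Y)) ((exponentialFunctor Z).map (Hom.snd X Y)))
    { toFun := fun p => Hom.lift p.1 p.2
      smooth := fun _ hc => mem_curves_exponential.2 fun a ha z hz =>
        ⟨mem_curves_exponential.1 hc.1 a ha z hz, mem_curves_exponential.1 hc.2 a ha z hz⟩ }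
    (fun _ => rfl) (fun _ => rfl)

/-! ### Weil prolongations -/

section Prolong

variable {W : WeilAlgebra}

theorem prolongFunction_toProlong (χ : X.functions) (f : SmoothFrom W.dim X) :
    X.prolongFunction W χ (f.toProlong W) = W.jet fun v => χ.1 (f.toFun v) :=
  (WeilAlgebra.jet_eq _).symm

theorem toProlong_eq_iff {f g : SmoothFrom W.dim X} :
    f.toProlong W = g.toProlong W ↔ f.toFun 0 = g.toFun 0 ∧
      ∀ χ ∈ X.functions, W.jet (fun v => χ (f.toFun v)) = W.jet fun v => χ (g.toFun v) := by
  refine Quotient.eq.trans (and_congr Iff.rfl ⟨fun h χ hχ => ?_, fun h χ => ?_⟩)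
  · rw [WeilAlgebra.jet_eq (f.smooth χ hχ), WeilAlgebra.jet_eq (g.smooth χ hχ)]
    exact Ideal.Quotient.eq.2 (h ⟨χ, hχ⟩)
  · have := h χ.1 χ.2
    rw [WeilAlgebra.jet_eq (f.smooth χ.1 χ.2), WeilAlgebra.jet_eq (g.smooth χ.1 χ.2)] at this
    exact Ideal.Quotient.eq.1 this

theorem exists_toProlong_eq (x : X.prolong W) : ∃ f : SmoothFrom W.dim X, f.toProlong W = x :=
  Quotient.exists_rep x

/-- The representatives need not be chosen smoothly in `t`: only their jets are tested, and joint
smoothness in `(t, v)` is never available. -/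
theorem mem_curves_prolong {c : ℝ → SmoothFrom W.dim X} :
    (fun t => (c t).toProlong W) ∈ (X.prolong W).curves ↔ ∀ χ ∈ X.functions,
      ∀ l : W.Carrier →ₗ[ℝ] ℝ, ContDiff ℝ ∞ fun t => l (W.jet fun v => χ ((c t).toFun v)) := by
  constructor
  · intro h χ hχ l
    have := h _ ⟨⟨χ, hχ⟩, l, rfl⟩
    simpa only [prolongFunction_toProlong] using this
  · rintro h _ ⟨χ, l, rfl⟩
    simpa only [prolongFunction_toProlong] using h χ.1 χ.2 l

/-- Every curve of a prolongation comes from a family of mappings. -/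
theorem exists_toProlong_eq_curve (c : ℝ → X.prolong W) :
    ∃ d : ℝ → SmoothFrom W.dim X, c = fun t => (d t).toProlong W := by
  choose d hd using fun t => exists_toProlong_eq (c t)
  exact ⟨d, (funext hd).symm⟩

theorem toProlong_map_eq (g : Hom X Y) {f f' : SmoothFrom W.dim X}
    (h : f.toProlong W = f'.toProlong W) :
    (f.map g).toProlong W = (f'.map g).toProlong W := by
  rw [toProlong_eq_iff] at h ⊢
  exact ⟨congrArg g.toFun h.1, fun χ hχ => h.2 _ (g.comp_mem_functions hχ)⟩

/-- The mapping of prolongations induced by a smooth mapping. -/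
def prolongMap (W : WeilAlgebra) (g : Hom X Y) : Hom (X.prolong W) (Y.prolong W) where
  toFun := Quotient.lift (fun f : SmoothFrom W.dim X => (f.map g).toProlong W)
    fun _ _ h => toProlong_map_eq g (Quotient.sound h)
  smooth c hc := by
    obtain ⟨d, rfl⟩ := exists_toProlong_eq_curve c
    rw [mem_curves_prolong] at hc
    exact mem_curves_prolong.2 fun χ hχ l => hc _ (g.comp_mem_functions hχ) l

/-- The functor `X ↦ X ⊗ W`. -/
def prolongFunctor (W : WeilAlgebra) : FrolicherSpace.{u} ⥤ FrolicherSpace.{u} where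
  obj X := X.prolong W
  map f := prolongMap W f
  map_id X := Hom.ext (funext fun x => by
    obtain ⟨f, rfl⟩ := exists_toProlong_eq x
    rfl)
  map_comp g h := Hom.ext (funext fun x => by
    obtain ⟨f, rfl⟩ := exists_toProlong_eq x
    rfl)

/-- A smooth mapping into `X^Y` has a class in `X ⊗ W` that depends smoothly on the point of `Y`. -/
def evalJet (W : WeilAlgebra) (F : SmoothFrom W.dim (X.exponential Y)) : Hom Y (X.prolong W) where
  toFun y := (F.evalAt y).toProlong W
  smooth y hy := mem_curves_prolong.2 fun χ hχ l => by
    refine WeilAlgebra.contDiff_jet_param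
      (H := fun v t => χ (Hom.toFun (F.toFun v) (y t))) ?_ l
    refine contDiff_of_smooth_along_curves fun c hc => contDiff_of_mem hχ ?_
    exact mem_curves_exponential.1 (F.isPlot _ (contDiff_fst.comp hc)) (fun t => t) contDiff_id _
      (comp_mem_curves hy (contDiff_snd.comp hc))

end Prolong

end FrolicherSpace

namespace FrolicherSpace

variable {X Y Z : FrolicherSpace.{u}} {W : WeilAlgebra}

/-! ### Weil prolongations of products -/

theorem snd_mem_functions {χ : X.prod Y → ℝ} (hχ : χ ∈ (X.prod Y).functions) (x : X) :
    (fun y => χ (x, y)) ∈ Y.functions :=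
  (Y.mem_functions_iff _).2 fun _ hc => contDiff_of_mem hχ ⟨const_mem_curves x, hc⟩

theorem fst_mem_functions {χ : X.prod Y → ℝ} (hχ : χ ∈ (X.prod Y).functions) (y : Y) :
    (fun x => χ (x, y)) ∈ X.functions :=
  (X.mem_functions_iff _).2 fun _ hc => contDiff_of_mem hχ ⟨hc, const_mem_curves y⟩

theorem swap_mem_functions {χ : X.prod Y → ℝ} (hχ : χ ∈ (X.prod Y).functions) :
    (fun p => χ (p.2, p.1)) ∈ (Y.prod X).functions :=
  ((Y.prod X).mem_functions_iff _).2 fun _ hc => contDiff_of_mem hχ ⟨hc.2, hc.1⟩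

/-- The function on `X × (Y ⊗ W)` obtained by prolonging a function on `X × Y` in the second
variable and composing with a linear functional. -/
def partialProlong {χ : X.prod Y → ℝ} (hχ : χ ∈ (X.prod Y).functions) (l : W.Carrier →ₗ[ℝ] ℝ)
    (p : X.prod (Y.prolong W)) : ℝ :=
  l (Y.prolongFunction W ⟨fun y => χ (p.1, y), snd_mem_functions hχ p.1⟩ p.2)

theorem partialProlong_toProlong {χ : X.prod Y → ℝ} (hχ : χ ∈ (X.prod Y).functions)
    (l : W.Carrier →ₗ[ℝ] ℝ) (x : X) (g : SmoothFrom W.dim Y) :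
    partialProlong hχ l (x, g.toProlong W) = l (W.jet fun v => χ (x, g.toFun v)) :=
  congrArg l (prolongFunction_toProlong _ g)

/-- Representatives of a curve of `Y ⊗ W` do not form a smooth family, so the two curve parameters
are separated: `r` for the curve in `X` and `t` for the one in `Y ⊗ W`. Weighted sums over `r`
commute with jets and turn `χ` into a function on `Y`, which a curve of `Y ⊗ W` can test. Thus the
expression is smooth in `(t, r)`, in particular on the diagonal. -/
theorem partialProlong_mem_functions {χ : X.prod Y → ℝ} (hχ : χ ∈ (X.prod Y).functions)
    (l : W.Carrier →ₗ[ℝ] ℝ) : partialProlong hχ l ∈ (X.prod (Y.prolong W)).functions := by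
  rintro c (hc₁ : (fun t => (c t).1) ∈ X.curves) (hc₂ : (fun t => (c t).2) ∈ (Y.prolong W).curves)
  obtain ⟨d, hd⟩ := exists_toProlong_eq_curve fun t => (c t).2
  rw [hd, mem_curves_prolong] at hc₂
  have hcd : ∀ t, partialProlong hχ l (c t) =
      l (W.jet fun v => χ ((c t).1, (d t).toFun v)) := fun t => by
    rw [← partialProlong_toProlong, ← congrFun hd t]
  simp only [hcd]
  have hH : ∀ t, ContDiff ℝ ∞ fun q : (Fin W.dim → ℝ) × ℝ => χ ((c q.2).1, (d t).toFun q.1) :=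
    fun t => IsPlot.contDiff (X := X.prod Y)
      (IsPlot.prodMk (isPlot_of_mem_curves hc₁).comp_snd (d t).isPlot.comp_fst) hχ
  have hj : ContDiff ℝ ∞ fun q : ℝ × ℝ => l (W.jet fun v => χ ((c q.2).1, (d q.1).toFun v)) := by
    refine contDiff_uncurry_of_weightedSum
      (h := fun t r => l (W.jet fun v => χ ((c r).1, (d t).toFun v)))
      (fun t => WeilAlgebra.contDiff_jet_param (hH t) l) fun R p w => ?_
    have hw : ∀ t, weightedSum p w (fun r => l (W.jet fun v => χ ((c r).1, (d t).toFun v))) =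
        l (W.jet fun v => weightedSum p w fun r => χ ((c r).1, (d t).toFun v)) := fun t =>
      (WeilAlgebra.jet_weightedSum p w (hH t) l).symm
    simp only [hw]
    refine hc₂ (fun y => weightedSum p w fun r => χ ((c r).1, y)) ?_ l
    refine (Y.mem_functions_iff _).2 fun e he => ?_
    exact contDiff_weightedSum p w (H := fun t r => χ ((c r).1, e t))
      (IsPlot.contDiff (X := X.prod Y) (IsPlot.prodMk (isPlot_of_mem_curves hc₁).comp_snd
        (isPlot_of_mem_curves he).comp_fst) hχ)
  exact hj.comp (contDiff_id.prodMk contDiff_id)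

/-- The pairing of two mappings. -/
def SmoothFrom.prodMk {n : ℕ} (f : SmoothFrom n X) (g : SmoothFrom n Y) :
    SmoothFrom n (X.prod Y) :=
  .ofIsPlot (fun v => (f.toFun v, g.toFun v)) (f.isPlot.prodMk g.isPlot)

/-- The mixed jet is a polarized expression in which `g` enters only through its class; the
remaining dependence on `f` is the jet of a function on `X`, so only its class matters too. -/
theorem jet_prodMk {χ : X.prod Y → ℝ} (hχ : χ ∈ (X.prod Y).functions) (f : SmoothFrom W.dim X)
    (g : SmoothFrom W.dim Y) {ι : Type*} [Fintype ι] (b : Module.Basis ι ℝ W.Carrier) :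
    W.jet (fun v => χ ((f.prodMk g).toFun v)) = ∑ i, ∑ j,
      b.coord j (W.jet fun x => partialProlong hχ (b.coord i) (f.toFun x, g.toProlong W)) •
        (b i * b j) := by
  simp only [partialProlong_toProlong]
  exact WeilAlgebra.jet_diag b (H := fun v x => χ (f.toFun x, g.toFun v))
    (IsPlot.contDiff (X := X.prod Y) (IsPlot.prodMk f.isPlot.comp_snd g.isPlot.comp_fst) hχ)

theorem toProlong_prodMk_eq {f f' : SmoothFrom W.dim X} {g g' : SmoothFrom W.dim Y}
    (hf : f.toProlong W = f'.toProlong W) (hg : g.toProlong W = g'.toProlong W) :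
    (f.prodMk g).toProlong W = (f'.prodMk g').toProlong W := by
  have := W.finite
  have b := Module.finBasis ℝ W.Carrier
  refine toProlong_eq_iff.2 ⟨Prod.ext (toProlong_eq_iff.1 hf).1 (toProlong_eq_iff.1 hg).1,
    fun χ hχ => ?_⟩
  rw [jet_prodMk hχ f g b, jet_prodMk hχ f' g' b, hg]
  refine Finset.sum_congr rfl fun i _ => Finset.sum_congr rfl fun j _ => ?_
  rw [(toProlong_eq_iff.1 hf).2 _
    (fst_mem_functions (partialProlong_mem_functions hχ (b.coord i)) (g'.toProlong W))]

/-- The canonical mapping `X ⊗ W × Y ⊗ W → (X × Y) ⊗ W`. -/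
def Hom.prolongProd (X Y : FrolicherSpace.{u}) (W : WeilAlgebra) :
    Hom ((X.prolong W).prod (Y.prolong W)) ((X.prod Y).prolong W) where
  toFun p := Quotient.lift₂ (fun (f : SmoothFrom W.dim X) (g : SmoothFrom W.dim Y) =>
    (f.prodMk g).toProlong W) (fun _ _ _ _ h h' =>
      toProlong_prodMk_eq (Quotient.sound h) (Quotient.sound h')) p.1 p.2
  smooth c hc := by
    have := W.finite
    have b := Module.finBasis ℝ W.Carrier
    obtain ⟨d, hd⟩ := exists_toProlong_eq_curve fun t => (c t).1
    obtain ⟨e, he⟩ := exists_toProlong_eq_curve fun t => (c t).2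
    have hce : c = fun t => ((d t).toProlong W, (e t).toProlong W) :=
      funext fun t => Prod.ext (congrFun hd t) (congrFun he t)
    subst hce
    refine mem_curves_prolong.2 fun χ hχ l => ?_
    simp only [jet_prodMk hχ _ _ b, map_sum, map_smul, smul_eq_mul]
    refine ContDiff.sum fun i _ => ContDiff.sum fun j _ => ContDiff.mul ?_ contDiff_const
    -- Prolong `χ` in the second variable, then the result in the first: a function on the product
    -- of `Y ⊗ W` and `X ⊗ W`, hence smooth along the given pair of curves.
    have h := partialProlong_mem_functions
      (swap_mem_functions (partialProlong_mem_functions hχ (b.coord i))) (b.coord j)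
      (fun t => ((e t).toProlong W, (d t).toProlong W)) hc.2 hc.1
    simpa only [partialProlong_toProlong] using h

/-- Weil prolongation preserves products. -/
def prodProlongIso (X Y : FrolicherSpace.{u}) (W : WeilAlgebra) :
    (X.prod Y).prolong W ≅ (X.prolong W).prod (Y.prolong W) :=
  mkIso (Hom.lift (prolongMap W (Hom.fst X Y)) (prolongMap W (Hom.snd X Y)))
    (Hom.prolongProd X Y W)
    (fun x => by
      obtain ⟨f, rfl⟩ := exists_toProlong_eq x
      rfl)
    (fun p => by
      obtain ⟨x, y⟩ := p
      obtain ⟨f, rfl⟩ := exists_toProlong_eq x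
      obtain ⟨g, rfl⟩ := exists_toProlong_eq y
      rfl)

end FrolicherSpace

namespace FrolicherSpace

variable {X Y Z : FrolicherSpace.{u}}

/-! ### Weil exponentiability of the point and of products -/

instance subsingleton_smoothFrom {n : ℕ} [Subsingleton X] : Subsingleton (SmoothFrom n X) :=
  ⟨fun _ _ => SmoothFrom.ext (Subsingleton.elim _ _)⟩

instance subsingleton_exponential [Subsingleton X] : Subsingleton (X.exponential Y) :=
  ⟨fun f g => Hom.ext (X := Y) (Y := X) (x := f) (y := g) (Subsingleton.elim _ _)⟩

instance subsingleton_prolong {W : WeilAlgebra} [Subsingleton X] : Subsingleton (X.prolong W) :=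
  ⟨fun x y => by
    obtain ⟨f, rfl⟩ := exists_toProlong_eq x
    obtain ⟨g, rfl⟩ := exists_toProlong_eq y
    rw [Subsingleton.elim f g]⟩

/-- The constant mapping. -/
def Hom.const (X : FrolicherSpace.{u}) (y : Y) : Hom X Y := ⟨fun _ => y, fun _ _ => const_mem_curves y⟩

/-- Both sides have exactly one element. -/
theorem isWeilExponentiable_point : IsWeilExponentiable point.{u} := by
  intro Y W₁ W₂
  have : Subsingleton point.{u} := inferInstanceAs (Subsingleton PUnit)
  let p : ∀ W : WeilAlgebra, point.{u}.prolong W := fun W =>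
    (SmoothFrom.const W.dim (X := point.{u}) PUnit.unit).toProlong W
  let x : (point.{u}.prolong (W₁.tensor W₂)).exponential Y := Hom.const Y (p _)
  let y : ((point.{u}.prolong W₁).exponential Y).prolong W₂ :=
    (SmoothFrom.const W₂.dim (X := (point.{u}.prolong W₁).exponential Y)
      (Hom.const Y (p _))).toProlong W₂
  exact ⟨mkIso (Hom.const _ y) (Hom.const _ x) (fun _ => Subsingleton.elim _ _)
    (fun _ => Subsingleton.elim _ _), fun _ _ _ _ _ => Subsingleton.elim _ _⟩

/-- Prolongation and exponentials preserve products, so the isomorphisms for the factors combine.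
Canonicity is checked after applying the two projections. -/
theorem IsWeilExponentiable.prod (hX : IsWeilExponentiable X) (hY : IsWeilExponentiable Y) :
    IsWeilExponentiable (X.prod Y) := by
  intro Z W₁ W₂
  obtain ⟨Φ, hΦ⟩ := hX Z W₁ W₂
  obtain ⟨Φ', hΦ'⟩ := hY Z W₁ W₂
  let L := (exponentialFunctor Z).mapIso (prodProlongIso X Y (W₁.tensor W₂)) ≪≫
    prodExponentialIso (X.prolong (W₁.tensor W₂)) (Y.prolong (W₁.tensor W₂)) Z
  let R := (prolongFunctor W₂).mapIso ((exponentialFunctor Z).mapIso (prodProlongIso X Y W₁) ≪≫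
    prodExponentialIso (X.prolong W₁) (Y.prolong W₁) Z) ≪≫ prodProlongIso _ _ W₂
  refine ⟨L ≪≫ prodIso Φ Φ' ≪≫ R.symm, fun F k h hk hh => ?_⟩
  have h₁ := hΦ (F.map ((exponentialFunctor Z).map (Hom.fst X Y)))
    (Hom.toFun L.hom k).1 (h.map ((exponentialFunctor Z).map (prolongMap W₁ (Hom.fst X Y))))
    (fun z => congrArg (prolongMap _ (Hom.fst X Y)).toFun (hk z))
    (fun w z => congrArg (prolongMap _ (Hom.fst X Y)).toFun (hh w z))
  have h₂ := hΦ' (F.map ((exponentialFunctor Z).map (Hom.snd X Y)))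
    (Hom.toFun L.hom k).2 (h.map ((exponentialFunctor Z).map (prolongMap W₁ (Hom.snd X Y))))
    (fun z => congrArg (prolongMap _ (Hom.snd X Y)).toFun (hk z))
    (fun w z => congrArg (prolongMap _ (Hom.snd X Y)).toFun (hh w z))
  exact (congrArg (Hom.toFun R.inv) (Prod.ext h₁ h₂)).trans (inv_hom_apply R (h.toProlong W₂))

/-! ### Change of Weil algebra -/

end FrolicherSpace

namespace WeilAlgebra

/-- The Weil algebra `ℝ`. -/
def real : WeilAlgebra where
  dim := 0
  ideal := ⊥
  ideal_le := bot_le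
  finite := SmoothFun.finite_of_pow_le (N := 1) (by
    rw [pow_one]
    exact fun f hf => SmoothFun.ext fun v => by
      rw [Subsingleton.elim v 0]
      exact hf)
  isLocal := SmoothFun.isLocal_of_pow_le (N := 1) (by
    rw [pow_one]
    exact fun f hf => SmoothFun.ext fun v => by
      rw [Subsingleton.elim v 0]
      exact hf) bot_le

/-- The augmentation of a Weil algebra. -/
def augmentation (W : WeilAlgebra) : W.Carrier →ₗ[ℝ] ℝ :=
  (Ideal.Quotient.liftₐ W.ideal (SmoothFun.eval 0) fun _ hf => W.ideal_le hf).toLinearMap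

theorem augmentation_jet {W : WeilAlgebra} {f : (Fin W.dim → ℝ) → ℝ} (hf : ContDiff ℝ ∞ f) :
    W.augmentation (W.jet f) = f 0 := by
  rw [jet_eq hf]
  rfl

/-- The linear mapping of Weil algebras induced by a smooth mapping. -/
def substLinear {W W' : WeilAlgebra} (φ : (Fin W'.dim → ℝ) → Fin W.dim → ℝ) (hφ : ContDiff ℝ ∞ φ)
    (h : ∀ f ∈ W.ideal, SmoothFun.subst φ hφ f ∈ W'.ideal) : W.Carrier →ₗ[ℝ] W'.Carrier :=
  (Ideal.Quotient.liftₐ W.ideal ((Ideal.Quotient.mkₐ ℝ W'.ideal).comp (SmoothFun.subst φ hφ))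
    fun f hf => Ideal.Quotient.eq_zero_iff_mem.2 (h f hf)).toLinearMap

theorem substLinear_jet {W W' : WeilAlgebra} {φ : (Fin W'.dim → ℝ) → Fin W.dim → ℝ}
    {hφ : ContDiff ℝ ∞ φ} (h : ∀ f ∈ W.ideal, SmoothFun.subst φ hφ f ∈ W'.ideal)
    {f : (Fin W.dim → ℝ) → ℝ} (hf : ContDiff ℝ ∞ f) :
    substLinear φ hφ h (W.jet f) = W'.jet fun v => f (φ v) := by
  have h2 : W'.jet (fun v => f (φ v)) = _ := jet_eq (hf.comp hφ)
  rw [jet_eq hf, h2]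
  rfl

end WeilAlgebra

namespace FrolicherSpace

variable {X Y Z : FrolicherSpace.{u}}

/-- The mapping of Weil prolongations induced by a substitution. -/
def reparamHom (X : FrolicherSpace.{u}) {W W' : WeilAlgebra}
    (φ : (Fin W'.dim → ℝ) → Fin W.dim → ℝ) (hφ : ContDiff ℝ ∞ φ)
    (h0 : φ 0 = 0) (h : ∀ f ∈ W.ideal, SmoothFun.subst φ hφ f ∈ W'.ideal) :
    Hom (X.prolong W) (X.prolong W') where
  toFun := Quotient.lift (fun f : SmoothFrom W.dim X => (f.reparam φ hφ).toProlong W')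
    fun f g hfg => by
      replace hfg : f.toProlong W = g.toProlong W := Quotient.sound hfg
      rw [toProlong_eq_iff] at hfg ⊢
      refine ⟨by simpa [SmoothFrom.reparam, h0] using hfg.1, fun χ hχ => ?_⟩
      have := congrArg (WeilAlgebra.substLinear φ hφ h) (hfg.2 χ hχ)
      rwa [WeilAlgebra.substLinear_jet h (f.smooth χ hχ),
        WeilAlgebra.substLinear_jet h (g.smooth χ hχ)] at this
  smooth c hc := by
    obtain ⟨d, rfl⟩ := exists_toProlong_eq_curve c
    rw [mem_curves_prolong] at hc
    refine mem_curves_prolong.2 fun χ hχ l => ?_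
    have := hc χ hχ (l.comp (WeilAlgebra.substLinear φ hφ h))
    simp only [LinearMap.comp_apply, WeilAlgebra.substLinear_jet h ((d _).smooth χ hχ)] at this
    exact this

/-- The isomorphism `X ⊗ ℝ ≅ X`. -/
def prolongRealIso (X : FrolicherSpace.{u}) : X.prolong WeilAlgebra.real ≅ X :=
  mkIso
    { toFun := Quotient.lift (fun f : SmoothFrom 0 X => f.toFun 0) fun _ _ h => h.1
      smooth := fun c hc => by
        obtain ⟨d, rfl⟩ := exists_toProlong_eq_curve c
        rw [mem_curves_prolong] at hc
        refine (X.mem_curves_iff _).2 fun χ hχ => ?_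
        have := hc χ hχ WeilAlgebra.real.augmentation
        simp only [WeilAlgebra.augmentation_jet ((d _).smooth χ hχ)] at this
        exact this }
    { toFun := fun x => (SmoothFrom.const 0 x).toProlong WeilAlgebra.real
      smooth := fun c hc => mem_curves_prolong.2 fun χ hχ l => by
        simp only [SmoothFrom.const, WeilAlgebra.jet_const_eq, Algebra.algebraMap_eq_smul_one,
          map_smul]
        exact (contDiff_of_mem hχ hc).smul contDiff_const }
    (fun x => by
      obtain ⟨f, rfl⟩ := exists_toProlong_eq x
      refine congrArg (SmoothFrom.toProlong WeilAlgebra.real) (SmoothFrom.ext (funext fun v => ?_))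
      exact congrArg f.toFun (Subsingleton.elim (α := Fin 0 → ℝ) _ _))
    (fun _ => rfl)

/-- The projection `ℝ⁰⁺ⁿ → ℝⁿ`. -/
def dropZero (n : ℕ) (v : Fin (0 + n) → ℝ) (i : Fin n) : ℝ := v (Fin.natAdd 0 i)

/-- The inverse of the projection `ℝ⁰⁺ⁿ → ℝⁿ`. -/
def addZero (n : ℕ) (v : Fin n → ℝ) (i : Fin (0 + n)) : ℝ := v (i.cast (zero_add n))

theorem contDiff_dropZero (n : ℕ) : ContDiff ℝ ∞ (dropZero n) :=
  contDiff_pi.2 fun _ => contDiff_apply ℝ ℝ _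

theorem contDiff_addZero (n : ℕ) : ContDiff ℝ ∞ (addZero n) :=
  contDiff_pi.2 fun _ => contDiff_apply ℝ ℝ _

theorem dropZero_addZero (n : ℕ) (v : Fin n → ℝ) : dropZero n (addZero n v) = v :=
  funext fun i => congrArg v (Fin.ext (by simp))

theorem addZero_dropZero (n : ℕ) (v : Fin (0 + n) → ℝ) : addZero n (dropZero n v) = v :=
  funext fun i => congrArg v (Fin.ext (by simp))

/-- The isomorphism `X ⊗ (ℝ ⊗_∞ W) ≅ X ⊗ W`. -/
def prolongRealTensorIso (X : FrolicherSpace.{u}) (W : WeilAlgebra) :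
    X.prolong (WeilAlgebra.real.tensor W) ≅ X.prolong W :=
  mkIso
    (reparamHom X (W := WeilAlgebra.real.tensor W) (W' := W) (addZero W.dim)
      (contDiff_addZero W.dim) rfl fun f hf => by
        have hle : WeilAlgebra.real.tensorIdeal W ≤
            W.ideal.comap (SmoothFun.subst (addZero W.dim) (contDiff_addZero W.dim)) := by
          refine sup_le (Ideal.map_le_iff_le_comap.2 ?_) (Ideal.map_le_iff_le_comap.2 fun g hg => ?_)
          · exact bot_le
          · have hg' : SmoothFun.subst (addZero W.dim) (contDiff_addZero W.dim)
                (SmoothFun.pullRight 0 W.dim g) = g :=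
              SmoothFun.ext fun v => congrArg g.toFun (dropZero_addZero W.dim v)
            change SmoothFun.subst (addZero W.dim) (contDiff_addZero W.dim)
              (SmoothFun.pullRight 0 W.dim g) ∈ W.ideal
            rwa [hg']
        exact hle hf)
    (reparamHom X (W := W) (W' := WeilAlgebra.real.tensor W) (dropZero W.dim)
      (contDiff_dropZero W.dim) rfl fun f hf =>
        Ideal.mem_sup_right (Ideal.mem_map_of_mem (SmoothFun.pullRight 0 W.dim) hf))
    (fun x => by
      obtain ⟨f, rfl⟩ := exists_toProlong_eq x
      refine congrArg (SmoothFrom.toProlong (WeilAlgebra.real.tensor W))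
        (SmoothFrom.ext (funext fun v => ?_))
      exact congrArg f.toFun (addZero_dropZero W.dim v))
    (fun x => by
      obtain ⟨f, rfl⟩ := exists_toProlong_eq x
      refine congrArg (SmoothFrom.toProlong W) (SmoothFrom.ext (funext fun v => ?_))
      exact congrArg f.toFun (dropZero_addZero W.dim v))

/-! ### Weil exponentiability of exponentials -/

/-- For a Weil-exponentiable space, Weil prolongation commutes with exponentials. -/
theorem IsWeilExponentiable.exists_prolong_exponential_iso (hX : IsWeilExponentiable X)
    (Z : FrolicherSpace.{u}) (W : WeilAlgebra) :
    ∃ Ψ : (X.exponential Z).prolong W ≅ (X.prolong W).exponential Z,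
      ∀ (G : SmoothFrom W.dim (X.exponential Z)) (z : Z),
        Hom.toFun (Hom.toFun Ψ.hom (G.toProlong W)) z = (G.evalAt z).toProlong W := by
  -- The case `W₁ = ℝ`, up to the identifications `X ⊗ ℝ ≅ X` and `X ⊗ (ℝ ⊗_∞ W) ≅ X ⊗ W`.
  -- Canonicity of `Φ` supplies the explicit formula.
  obtain ⟨Φ, hΦ⟩ := hX Z WeilAlgebra.real W
  let A := (prolongFunctor W).mapIso ((exponentialFunctor Z).mapIso (prolongRealIso X).symm)
  let B := (exponentialFunctor Z).mapIso (prolongRealTensorIso X W)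
  refine ⟨A ≪≫ Φ.symm ≪≫ B, fun G z => ?_⟩
  let F : SmoothFrom (0 + W.dim) (X.exponential Z) :=
    G.reparam (dropZero W.dim) (contDiff_dropZero W.dim)
  let k : (X.prolong (WeilAlgebra.real.tensor W)).exponential Z :=
    evalJet (WeilAlgebra.real.tensor W) F
  let h : SmoothFrom W.dim ((X.prolong WeilAlgebra.real).exponential Z) :=
    G.map ((exponentialFunctor Z).map (prolongRealIso X).inv)
  have hk : Hom.toFun Φ.hom k = h.toProlong W := hΦ F k h (fun _ => rfl) fun w z => by
    refine congrArg (SmoothFrom.toProlong WeilAlgebra.real) (SmoothFrom.ext (funext fun v => ?_))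
    have : dropZero W.dim (Fin.append (v : Fin 0 → ℝ) w) = w :=
      funext fun i => Fin.append_right (v : Fin 0 → ℝ) w i
    exact congrArg (fun w => Hom.toFun (G.toFun w) z) this.symm
  have hk' : Hom.toFun Φ.inv (h.toProlong W) = k := by
    rw [← hk]
    exact inv_hom_apply Φ k
  have h1 : Hom.toFun (A ≪≫ Φ.symm ≪≫ B).hom (G.toProlong W) =
      Hom.toFun B.hom (Hom.toFun Φ.inv (h.toProlong W)) := rfl
  refine (congrArg (fun g : (X.prolong W).exponential Z => Hom.toFun g z)
    (h1.trans (congrArg (Hom.toFun B.hom) hk'))).trans ?_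
  refine congrArg (SmoothFrom.toProlong W) (SmoothFrom.ext (funext fun v => ?_))
  exact congrArg (fun w => Hom.toFun (G.toFun w) z) (dropZero_addZero W.dim v)

/-- Pull `Z` out of the prolongation on both sides, merge it with `Y` by the exponential law, and
use the hypothesis for the single exponent `Z × Y`. The explicit formulas for `Ψ` and `Ψ₁` carry
canonicity through the chain. -/
theorem IsWeilExponentiable.exponential (hX : IsWeilExponentiable X) (Z : FrolicherSpace.{u}) :
    IsWeilExponentiable (X.exponential Z) := by
  intro Y W₁ W₂
  obtain ⟨Φ, hΦ⟩ := hX (Z.prod Y) W₁ W₂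
  obtain ⟨Ψ, hΨ⟩ := hX.exists_prolong_exponential_iso Z (W₁.tensor W₂)
  obtain ⟨Ψ₁, hΨ₁⟩ := hX.exists_prolong_exponential_iso Z W₁
  let L := (exponentialFunctor Y).mapIso Ψ ≪≫ exponentialProdIso (X.prolong (W₁.tensor W₂)) Y Z
  let R₀ := (exponentialFunctor Y).mapIso Ψ₁ ≪≫ exponentialProdIso (X.prolong W₁) Y Z
  let R := (prolongFunctor W₂).mapIso R₀
  refine ⟨L ≪≫ Φ ≪≫ R.symm, fun F k h hk hh => ?_⟩
  have h₁ := hΦ (F.map (exponentialProdIso X Y Z).hom) (Hom.toFun L.hom k) (h.map R₀.hom)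
    (fun p => ?_) (fun w p => ?_)
  · exact (congrArg (Hom.toFun R.inv) h₁).trans (inv_hom_apply R (h.toProlong W₂))
  · exact (congrArg (fun x => Hom.toFun (Hom.toFun Ψ.hom x) p.1) (hk p.2)).trans
      (hΨ (F.evalAt p.2) p.1)
  · exact (congrArg (fun x => Hom.toFun (Hom.toFun Ψ₁.hom x) p.1) (hh w p.2)).trans
      (hΨ₁ ((F.evalAt p.2).slice w) p.1)

end FrolicherSpace

/-! ### The category of Weil-exponentiable Frölicher spaces -/

namespace WeilExponentiableFrolicherSpace

open Limits FrolicherSpace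

variable (X Y : WeilExponentiableFrolicherSpace.{u})

/-- The product of two Weil-exponentiable spaces. -/
def prod : WeilExponentiableFrolicherSpace.{u} := ⟨X.obj.prod Y.obj, X.property.prod Y.property⟩

/-- The point. -/
def point : WeilExponentiableFrolicherSpace.{u} := ⟨FrolicherSpace.point, isWeilExponentiable_point⟩

/-- The point is a terminal object. -/
def terminalLimitCone : LimitCone (Functor.empty WeilExponentiableFrolicherSpace.{u}) where
  cone := asEmptyCone point
  isLimit := IsTerminal.ofUniqueHom (fun X => ObjectProperty.homMk (Hom.toPoint X.obj))
    fun _ _ => ObjectProperty.hom_ext _ (Hom.ext rfl)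

/-- The product with the two projections is a categorical product. -/
def productLimitCone : LimitCone (pair X Y) where
  cone := BinaryFan.mk (P := prod X Y) (ObjectProperty.homMk (Hom.fst X.obj Y.obj))
    (ObjectProperty.homMk (Hom.snd X.obj Y.obj))
  isLimit := BinaryFan.IsLimit.mk _
    (fun f g => ObjectProperty.homMk (Hom.lift f.hom g.hom))
    (fun _ _ => rfl) (fun _ _ => rfl)
    (fun f g m h₁ h₂ => by subst h₁ h₂; rfl)

instance : CartesianMonoidalCategory WeilExponentiableFrolicherSpace.{u} where
  -- Tensor product and unit are given explicitly as the product and the point above, so that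
  -- currying on `Y.obj.prod Z.obj` yields the adjunction directly.
  tensorObj X Y := prod X Y
  tensorUnit := point
  __ := CartesianMonoidalCategory.ofChosenFiniteProducts terminalLimitCone productLimitCone

/-- The functor `Z ↦ Z^Y`. -/
def exponentialFunctor : WeilExponentiableFrolicherSpace.{u} ⥤ WeilExponentiableFrolicherSpace.{u} :=
  ObjectProperty.lift _ (ObjectProperty.ι _ ⋙ FrolicherSpace.exponentialFunctor Y.obj)
    fun X => X.property.exponential Y.obj

/-- The exponential law: `Y × -` is left adjoint to `(-)^Y`. -/
def exponentialAdjunction : MonoidalCategory.tensorLeft Y ⊣ exponentialFunctor Y :=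
  Adjunction.mkOfHomEquiv
    { homEquiv := fun _ _ =>
        { toFun := fun f => ObjectProperty.homMk (Hom.curry f.hom)
          invFun := fun f => ObjectProperty.homMk (Hom.uncurry f.hom)
          left_inv := fun _ => rfl
          right_inv := fun _ => rfl }
      homEquiv_naturality_left_symm := fun _ _ => rfl
      homEquiv_naturality_right := fun _ _ => rfl }

instance : MonoidalClosed WeilExponentiableFrolicherSpace.{u} where
  closed Y := { rightAdj := exponentialFunctor Y, adj := exponentialAdjunction Y }

end WeilExponentiableFrolicherSpace

end

/-- The category of Weil-exponentiable Frölicher spaces is cartesian closed: it has finite products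
and each functor `X × -` has a right adjoint. -/
theorem theorem4p4 :
    ∃ _ : CartesianMonoidalCategory WeilExponentiableFrolicherSpace.{u},
      Nonempty (MonoidalClosed WeilExponentiableFrolicherSpace.{u}) :=
  ⟨inferInstance, ⟨inferInstance⟩⟩
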